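/- All manifolds, metrics, tensor fields, curves and vector fields are smooth ($C^\infty$), and $n \ge 0$ is an integer. A contact metric structure on a manifold $N$ of dimension $2n+1$ is a quadruple $(\varphi,\xi,\eta,g)$ of a $(1,1)$-tensor field $\varphi$, a vector field $\xi$, a $1$-form $\eta$ and a Riemannian metric $g$ such that, for all vector fields $X,Y$, $$\varphi^2=-\mathrm{Id}+\eta\otimes\xi,\quad \eta(\xi)=1,\quad g(\varphi X,\varphi Y)=g(X,Y)-\eta(X)\eta(Y),\quad g(X,\varphi Y)=d\eta(X,Y),$$ where $2\,d\eta(X,Y)=X(\eta(Y))-Y(\eta(X))-\eta([X,Y])$. It is Sasakian if $N_\varphi+2\,d\eta\otimes\xi=0$, where $N_\varphi(X,Y)=[\varphi X,\varphi Y]-\varphi[\varphi X,Y]-\varphi[X,\varphi Y]+\varphi^2[X,Y]$. A Sasakian manifold is a Sasakian space form $N^{2n+1}(c)$ if the sectional curvature of the plane spanned by $X$ and $\varphi X$ equals the constant $c$ for every unit tangent vector $X$ orthogonal to $\xi$. Let $I\subset\mathbb R$ be a nonempty open interval, let $\gamma:I\to N$ be a curve parametrized by arc length, $T=\gamma'$,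 and let $\nabla$ and $R(X,Y)=\nabla_X\nabla_Y-\nabla_Y\nabla_X-\nabla_{[X,Y]}$ be the Levi-Civita connection and the curvature of $g$. The curve $\gamma$ is a Frenet curve of osculating order $r$, $1\le r\le 2n+1$, if there are orthonormal vector fields $E_1=T,E_2,\dots,E_r$ along $\gamma$ and positive functions $\kappa_1,\dots,\kappa_{r-1}$ on $I$ with $$\nabla_T E_i=-\kappa_{i-1}E_{i-1}+\kappa_iE_{i+1}\qquad(1\le i\le r),$$ where the term with $\kappa_{i-1}$ is omitted for $i=1$ and the term with $\kappa_i$ is omitted for $i=r$. A circle is a Frenet curve of osculating order $2$ with $\kappa_1$ constant; a helix is a Frenet curve of osculating order $3$ with $\kappa_1,\kappa_2$ constant. The curve $\gamma$ is Legendre if $\eta(T)=0$. It is harmonic if $\tau(\gamma)=\nabla_TT$ vanishes identically, biharmonic if $\tau_2(\gamma)=\nabla_T\nabla_T\tau(\gamma)-R(T,\tau(\gamma))T$ vanishes identically, and proper-biharmonic if it is biharmonic and not harmonic. **Theorem.** Let $\gamma:I\to N$ be a Legendre Frenet curve of osculating order $r$ in a Sasakian space form $N^{2n+1}(c)$ with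 $c=1$. Then $\gamma$ is proper-biharmonic if and only if $n\ge 2$ and either $\gamma$ is a circle with $\kappa_1=1$, or $\gamma$ is a helix with $\kappa_1^2+\kappa_2^2=1$. -/

import Mathlib

open Bundle Set
open scoped Manifold ContDiff

noncomputable section

/-! ### Riemannian geometry in charts

Manifolds of dimension `m` are modelled on `EuclideanSpace ℝ (Fin m)`. For `p : M`, the preferred
chart `extChartAt 𝓡(m) p` and the trivialization `trivializationAt _ _ p` of the tangent bundle
that it induces provide the local coordinates around `p`. In Mathlib the tangent space at `p` is
the model space, a tangent vector at `p` being identified with its components in the preferred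
chart at `p`. -/

section Riemannian

variable {m : ℕ} {M : Type*} [TopologicalSpace M] [ChartedSpace (EuclideanSpace ℝ (Fin m)) M]
  [IsManifold (𝓡 m) ∞ M]

/-- Smooth Riemannian metrics on the `m`-dimensional manifold `M`. -/
abbrev SmoothMetric (m : ℕ) (M : Type*) [TopologicalSpace M]
    [ChartedSpace (EuclideanSpace ℝ (Fin m)) M] [IsManifold (𝓡 m) ∞ M] :=
  ContMDiffRiemannianMetric (𝓡 m) ∞ (EuclideanSpace ℝ (Fin m))
    (fun x : M => TangentSpace (𝓡 m) x)

/-- The metric read in the preferred chart at `p`: the product, at the point with coordinates `y`,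
of the tangent vectors with components `u` and `v`. -/
def metricInChart (g : SmoothMetric m M) (p : M) (y u v : EuclideanSpace ℝ (Fin m)) : ℝ :=
  let q : M := (extChartAt (𝓡 m) p).symm y
  let e := trivializationAt (EuclideanSpace ℝ (Fin m)) (fun x : M => TangentSpace (𝓡 m) x) p
  g.inner q (e.symm q u) (e.symm q v)

/-- The matrix `(g_ij)` of the metric in the preferred chart at `p`. -/
def gramMatrix (g : SmoothMetric m M) (p : M) (y : EuclideanSpace ℝ (Fin m)) :
    Matrix (Fin m) (Fin m) ℝ :=
  Matrix.of fun i j =>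
    metricInChart g p y (EuclideanSpace.single i 1) (EuclideanSpace.single j 1)

/-- Christoffel symbols of the first kind, as a function of three vectors:
`(∂_u g(v, w) + ∂_v g(u, w) - ∂_w g(u, v)) / 2`. -/
def christoffelFirst (g : SmoothMetric m M) (p : M) (y u v w : EuclideanSpace ℝ (Fin m)) : ℝ :=
  (fderiv ℝ (fun z => metricInChart g p z v w) y u
    + fderiv ℝ (fun z => metricInChart g p z u w) y v
    - fderiv ℝ (fun z => metricInChart g p z u v) y w) / 2

/-- Christoffel symbols of the Levi-Civita connection in the preferred chart at `p`: the vector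
`Γ(u, v)` with components `Γ^k(u, v) = ∑ l, g^{kl} Γ_l(u, v)`. -/
def christoffel (g : SmoothMetric m M) (p : M) (y u v : EuclideanSpace ℝ (Fin m)) :
    EuclideanSpace ℝ (Fin m) :=
  WithLp.toLp 2 fun k => ∑ l, (gramMatrix g p y)⁻¹ k l *
    christoffelFirst g p y u v (EuclideanSpace.single l 1)

/-- The curvature operator `R(X, Y)Z = ∇_X ∇_Y Z - ∇_Y ∇_X Z - ∇_[X, Y] Z` of the Levi-Civita
connection at `p`, computed in the preferred chart at `p` (for vector fields `X`, `Y`, `Z` with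
constant components). -/
def curvatureOp (g : SmoothMetric m M) (p : M) (X Y Z : TangentSpace (𝓡 m) p) :
    TangentSpace (𝓡 m) p :=
  let y : EuclideanSpace ℝ (Fin m) := extChartAt (𝓡 m) p p
  let Γ := christoffel g p
  (fderiv ℝ (fun z => Γ z Y Z) y X - fderiv ℝ (fun z => Γ z X Z) y Y
    + Γ y X (Γ y Y Z) - Γ y Y (Γ y X Z) : EuclideanSpace ℝ (Fin m))

/-- The sectional curvature of the plane spanned by `X` and `Y`. -/
def sectionalCurvature (g : SmoothMetric m M) (p : M) (X Y : TangentSpace (𝓡 m) p) : ℝ :=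
  g.inner p (curvatureOp g p X Y Y) X /
    (g.inner p X X * g.inner p Y Y - g.inner p X Y ^ 2)

/-- The velocity `γ'(t)`. -/
def velocity (m : ℕ) {M : Type*} [TopologicalSpace M]
    [ChartedSpace (EuclideanSpace ℝ (Fin m)) M] (γ : ℝ → M) (t : ℝ) : TangentSpace (𝓡 m) (γ t) :=
  mfderiv 𝓘(ℝ, ℝ) (𝓡 m) γ t (1 : ℝ)

/-- The covariant derivative `∇_T V` at time `t` of a vector field `V` along the curve `γ`, for the
Levi-Civita connection: in the preferred chart at `γ t` it is `V' + Γ(γ', V)`. -/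
def covDerivAlong (g : SmoothMetric m M) (γ : ℝ → M) (V : ∀ t, TangentSpace (𝓡 m) (γ t)) (t : ℝ) :
    TangentSpace (𝓡 m) (γ t) :=
  let e := trivializationAt (EuclideanSpace ℝ (Fin m)) (fun x : M => TangentSpace (𝓡 m) x) (γ t)
  (deriv (fun s => (e ⟨γ s, V s⟩).2) t
    + christoffel g (γ t) (extChartAt (𝓡 m) (γ t) (γ t)) (velocity m γ t) (V t) :
      EuclideanSpace ℝ (Fin m))

/-- Smoothness on `I` of a vector field along a curve. -/
def SmoothAlongOn (m : ℕ) {M : Type*} [TopologicalSpace M]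
    [ChartedSpace (EuclideanSpace ℝ (Fin m)) M] [IsManifold (𝓡 m) ∞ M]
    (I : Set ℝ) (γ : ℝ → M) (V : ∀ t, TangentSpace (𝓡 m) (γ t)) : Prop :=
  ContMDiffOn 𝓘(ℝ, ℝ) (𝓡 m).tangent ∞ (fun t => (⟨γ t, V t⟩ : TangentBundle (𝓡 m) M)) I

/-- The tension field `τ(γ) = trace ∇dγ = ∇_T T` of a curve. -/
def tensionField (g : SmoothMetric m M) (γ : ℝ → M) : ∀ t, TangentSpace (𝓡 m) (γ t) :=
  covDerivAlong g γ (velocity m γ)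

/-- The bitension field `τ₂(γ) = -Δτ(γ) - trace R(dγ, τ(γ))dγ = ∇_T ∇_T τ(γ) - R(T, τ(γ))T` of a
curve. -/
def bitensionField (g : SmoothMetric m M) (γ : ℝ → M) (t : ℝ) : TangentSpace (𝓡 m) (γ t) :=
  covDerivAlong g γ (covDerivAlong g γ (tensionField g γ)) t
    - curvatureOp g (γ t) (velocity m γ t) (tensionField g γ t) (velocity m γ t)

/-- The curve `γ` is harmonic on `I`. -/
def IsHarmonicCurve (g : SmoothMetric m M) (I : Set ℝ) (γ : ℝ → M) : Prop :=
  ∀ t ∈ I, tensionField g γ t = 0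

/-- The curve `γ` is biharmonic on `I`. -/
def IsBiharmonicCurve (g : SmoothMetric m M) (I : Set ℝ) (γ : ℝ → M) : Prop :=
  ∀ t ∈ I, bitensionField g γ t = 0

/-- The curve `γ` is proper-biharmonic on `I`: biharmonic and not harmonic. -/
def IsProperBiharmonicCurve (g : SmoothMetric m M) (I : Set ℝ) (γ : ℝ → M) : Prop :=
  IsBiharmonicCurve g I γ ∧ ¬ IsHarmonicCurve g I γ

/-- `E 1, …, E r` is a Frenet frame of osculating order `r`, with curvatures `κ 1, …, κ (r - 1)`,
of the curve `γ : I → M` parametrized by arc length. (The values of `E` and `κ` at other indices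
are irrelevant.) -/
structure IsFrenetFrame (g : SmoothMetric m M) (I : Set ℝ) (γ : ℝ → M) (r : ℕ)
    (E : ℕ → ∀ t, TangentSpace (𝓡 m) (γ t)) (κ : ℕ → ℝ → ℝ) : Prop where
  one_le : 1 ≤ r
  le_dim : r ≤ m
  smooth_curve : ContMDiffOn 𝓘(ℝ, ℝ) (𝓡 m) ∞ γ I
  smooth_frame : ∀ i ∈ Icc 1 r, SmoothAlongOn m I γ (E i)
  smooth_curvature : ∀ i ∈ Ico 1 r, ContDiffOn ℝ ∞ (κ i) I
  orthonormal : ∀ t ∈ I, ∀ i ∈ Icc 1 r, ∀ j ∈ Icc 1 r,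
    g.inner (γ t) (E i t) (E j t) = if i = j then 1 else 0
  velocity_eq : ∀ t ∈ I, E 1 t = velocity m γ t
  curvature_pos : ∀ t ∈ I, ∀ i ∈ Ico 1 r, 0 < κ i t
  frenet : ∀ t ∈ I, ∀ i ∈ Icc 1 r, covDerivAlong g γ (E i) t =
    (if 1 < i then -(κ (i - 1) t • E (i - 1) t) else 0) +
      (if i < r then κ i t • E (i + 1) t else 0)

/-- `γ : I → M` is a Frenet curve of osculating order `r`. -/
def IsFrenetCurve (g : SmoothMetric m M) (I : Set ℝ) (γ : ℝ → M) (r : ℕ) : Prop :=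
  ∃ E κ, IsFrenetFrame g I γ r E κ

/-- `γ` is a circle with constant curvature `κ₁ = k₁`. -/
def IsCircle (g : SmoothMetric m M) (I : Set ℝ) (γ : ℝ → M) (k₁ : ℝ) : Prop :=
  ∃ E κ, IsFrenetFrame g I γ 2 E κ ∧ ∀ t ∈ I, κ 1 t = k₁

/-- `γ` is a helix (of order `3`) with constant curvatures `κ₁ = k₁` and `κ₂ = k₂`. -/
def IsHelix (g : SmoothMetric m M) (I : Set ℝ) (γ : ℝ → M) (k₁ k₂ : ℝ) : Prop :=
  ∃ E κ, IsFrenetFrame g I γ 3 E κ ∧ ∀ t ∈ I, κ 1 t = k₁ ∧ κ 2 t = k₂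

end Riemannian

/-! ### Sasakian space forms -/

section Sasakian

variable {m : ℕ} {M : Type*} [TopologicalSpace M] [ChartedSpace (EuclideanSpace ℝ (Fin m)) M]
  [IsManifold (𝓡 m) ∞ M]

/-- The vector field `X` is smooth around `p`. -/
def SmoothVectorFieldAt (X : ∀ x : M, TangentSpace (𝓡 m) x) (p : M) : Prop :=
  ContMDiffAt (𝓡 m) (𝓡 m).tangent ∞ (fun x => (⟨x, X x⟩ : TangentBundle (𝓡 m) M)) p

/-- The exterior derivative of a `1`-form `η` evaluated on vector fields, with the normalization
`2 dη(X, Y) = X (η Y) - Y (η X) - η [X, Y]` customary in contact metric geometry. -/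
def extDerivForm (η : ∀ x : M, TangentSpace (𝓡 m) x →L[ℝ] ℝ)
    (X Y : ∀ x : M, TangentSpace (𝓡 m) x) (p : M) : ℝ :=
  (mvfderiv (𝓡 m) (fun x => η x (Y x)) p (X p) - mvfderiv (𝓡 m) (fun x => η x (X x)) p (Y p)
    - η p (VectorField.mlieBracket (𝓡 m) X Y p)) / 2

/-- The Nijenhuis tensor
`N_φ(X, Y) = [φX, φY] - φ[φX, Y] - φ[X, φY] + φ²[X, Y]` evaluated on vector fields. -/
def nijenhuis (φ : ∀ x : M, TangentSpace (𝓡 m) x →L[ℝ] TangentSpace (𝓡 m) x)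
    (X Y : ∀ x : M, TangentSpace (𝓡 m) x) (p : M) : TangentSpace (𝓡 m) p :=
  VectorField.mlieBracket (𝓡 m) (fun x => φ x (X x)) (fun x => φ x (Y x)) p
    - φ p (VectorField.mlieBracket (𝓡 m) (fun x => φ x (X x)) Y p)
    - φ p (VectorField.mlieBracket (𝓡 m) X (fun x => φ x (Y x)) p)
    + φ p (φ p (VectorField.mlieBracket (𝓡 m) X Y p))

/-- Contact metric structures `(φ, ξ, η, g)` on a manifold of dimension `2n + 1`. -/
structure ContactMetricStructure (n : ℕ) (M : Type*) [TopologicalSpace M]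
    [ChartedSpace (EuclideanSpace ℝ (Fin (2 * n + 1))) M]
    [IsManifold (𝓡 (2 * n + 1)) ∞ M] where
  /-- The Riemannian metric. -/
  g : SmoothMetric (2 * n + 1) M
  /-- The tensor field of type `(1, 1)`. -/
  φ : ∀ x : M, TangentSpace (𝓡 (2 * n + 1)) x →L[ℝ] TangentSpace (𝓡 (2 * n + 1)) x
  /-- The characteristic vector field. -/
  ξ : ∀ x : M, TangentSpace (𝓡 (2 * n + 1)) x
  /-- The contact form. -/
  η : ∀ x : M, TangentSpace (𝓡 (2 * n + 1)) x →L[ℝ] ℝ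
  smooth_φ : ContMDiff (𝓡 (2 * n + 1))
    ((𝓡 (2 * n + 1)).prod
      𝓘(ℝ, EuclideanSpace ℝ (Fin (2 * n + 1)) →L[ℝ] EuclideanSpace ℝ (Fin (2 * n + 1)))) ∞
    (fun x => TotalSpace.mk'
      (EuclideanSpace ℝ (Fin (2 * n + 1)) →L[ℝ] EuclideanSpace ℝ (Fin (2 * n + 1)))
      (E := fun x : M => TangentSpace (𝓡 (2 * n + 1)) x →L[ℝ] TangentSpace (𝓡 (2 * n + 1)) x)
      x (φ x))
  smooth_ξ : ∀ p, SmoothVectorFieldAt ξ p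
  smooth_η : ContMDiff (𝓡 (2 * n + 1))
    ((𝓡 (2 * n + 1)).prod 𝓘(ℝ, EuclideanSpace ℝ (Fin (2 * n + 1)) →L[ℝ] ℝ)) ∞
    (fun x => TotalSpace.mk' (EuclideanSpace ℝ (Fin (2 * n + 1)) →L[ℝ] ℝ)
      (E := fun x : M => TangentSpace (𝓡 (2 * n + 1)) x →L[ℝ] ℝ) x (η x))
  φ_φ : ∀ p X, φ p (φ p X) = -X + η p X • ξ p
  η_ξ : ∀ p, η p (ξ p) = 1
  g_φ_φ : ∀ p X Y, g.inner p (φ p X) (φ p Y) = g.inner p X Y - η p X * η p Y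
  g_φ : ∀ p X Y, SmoothVectorFieldAt X p → SmoothVectorFieldAt Y p →
    g.inner p (X p) (φ p (Y p)) = extDerivForm η X Y p

/-- Sasakian structures: normal contact metric structures. -/
structure SasakianStructure (n : ℕ) (M : Type*) [TopologicalSpace M]
    [ChartedSpace (EuclideanSpace ℝ (Fin (2 * n + 1))) M]
    [IsManifold (𝓡 (2 * n + 1)) ∞ M] extends ContactMetricStructure n M where
  normal : ∀ p X Y, SmoothVectorFieldAt X p → SmoothVectorFieldAt Y p →
    nijenhuis φ X Y p + (2 * extDerivForm η X Y p) • ξ p = 0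

variable {n : ℕ} {N : Type*} [TopologicalSpace N]
  [ChartedSpace (EuclideanSpace ℝ (Fin (2 * n + 1))) N] [IsManifold (𝓡 (2 * n + 1)) ∞ N]

/-- A Sasakian space form with constant `φ`-sectional curvature `c`: every plane spanned by `X` and
`φX`, where `X` is a unit vector orthogonal to `ξ`, has sectional curvature `c`. -/
def SasakianStructure.IsSpaceForm (S : SasakianStructure n N) (c : ℝ) : Prop :=
  ∀ (p : N) (X : TangentSpace (𝓡 (2 * n + 1)) p), S.g.inner p X X = 1 →
    S.g.inner p X (S.ξ p) = 0 → sectionalCurvature S.g p X (S.φ p X) = c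

/-- The curve `γ : I → N` is a Legendre curve: it is tangent to the contact distribution
`ker η`. -/
def SasakianStructure.IsLegendre (S : SasakianStructure n N) (I : Set ℝ) (γ : ℝ → N) : Prop :=
  ∀ t ∈ I, S.η (γ t) (velocity (2 * n + 1) γ t) = 0

end Sasakian

end

/-! The value `c = 1` is special because a Sasakian space form with `c = 1` has constant sectional
curvature 1. In particular `R(T, X)T = -X` for a unit vector `T` and `X` orthogonal to it, and no
term with `φ` survives in the biharmonic equation.

The curvature statement has two steps. Normality together with closedness of the fundamental form
gives `(∇_X φ)Y = g(X, Y)ξ - η(Y)X` and `∇_X ξ = -φX` (`IsLocalSasakian.covDeriv`). Differentiating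
once more computes the commutator of `R(X, Y)` with `φ` (`curvature_comm_φ`). It is the same
commutator as for the constant curvature tensor, so the difference `B` of the two tensors is
compatible with `φ` and kills `ξ`. Its `φ`-sectional curvature is zero, and polarization as in
Kähler geometry gives `B(X, Y, X, W) = 0` (`sectional_eq_zero_of_holomorphic`).

The Frenet equations then give the components of the bitension field along `E₁, …, E₄`: `-3κ₁κ₁'`,
`κ₁'' - κ₁³ - κ₁κ₂² + κ₁`, `2κ₁'κ₂ + κ₁κ₂'` and `κ₁κ₂κ₃`. A curve that is not harmonic has `r ≥ 2`,
hence `κ₁ > 0`. Vanishing of the components means that `κ₁` and `κ₂` are constant, `κ₁² + κ₂² = 1`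
and `r ≤ 3`: a circle or a helix.

The bound `n ≥ 2` comes from the Legendre condition. Differentiating `η(T) = 0` twice gives `η(E₂) =
0` and `g(E₂, φT) = κ₂ η(E₃)`. In dimension at most 3 the vectors `T, φT, ξ` leave only `E₂ = ±φT`,
so that `κ₂² ≥ 1`, whereas `κ₂² = 1 - κ₁² < 1`.

Tensor identities are proved on open subsets of a normed space and transferred through the preferred
chart at each point. -/

noncomputable section

/-! ### Linear algebra of almost contact metric structures and curvature tensors at a point. -/

section PointwiseAlgebra

variable {E : Type*} [NormedAddCommGroup E] [NormedSpace ℝ E]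

/-- An almost contact metric structure on a vector space: the values of a metric, of a tensor of
type `(1, 1)`, of a vector field and of a `1`-form at a point. -/
structure IsAlmostContactMetric (g : E →L[ℝ] E →L[ℝ] ℝ) (φ : E →L[ℝ] E) (ξ : E)
    (η : E →L[ℝ] ℝ) : Prop where
  symm : ∀ X Y, g X Y = g Y X
  pos : ∀ X, X ≠ 0 → 0 < g X X
  φ_φ : ∀ X, φ (φ X) = -X + η X • ξ
  η_ξ : η ξ = 1
  g_φ_φ : ∀ X Y, g (φ X) (φ Y) = g X Y - η X * η Y

namespace IsAlmostContactMetric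

variable {g : E →L[ℝ] E →L[ℝ] ℝ} {φ : E →L[ℝ] E} {ξ : E} {η : E →L[ℝ] ℝ}

lemma eq_of_inner (h : IsAlmostContactMetric g φ ξ η) {X Y : E} (hXY : ∀ Z, g X Z = g Y Z) :
    X = Y := by
  by_contra hne
  have := h.pos (X - Y) (sub_ne_zero.2 hne)
  simp [hXY] at this

/-- Since `φ²ξ = 0`, also `φ³ξ = 0`, which makes `φξ = η(φξ)ξ`. Applying `φ` gives `η(φξ) φξ = 0`,
and either factor being zero makes `φξ` vanish. -/
lemma φ_ξ (h : IsAlmostContactMetric g φ ξ η) : φ ξ = 0 := by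
  by_contra hne
  have h1 := h.pos _ hne
  have h2 := h.g_φ_φ ξ ξ
  have h3 : φ (φ ξ) = 0 := by rw [h.φ_φ, h.η_ξ]; simp
  have h4 := h.pos _ hne
  have h5 := h.g_φ_φ (φ ξ) (φ ξ)
  rw [h3] at h5
  have h6 : φ (φ (φ ξ)) = 0 := by rw [h3, map_zero]
  rw [h.φ_φ] at h6
  have h7 : φ ξ = η (φ ξ) • ξ := by
    have := congrArg (fun x => φ ξ + x) h6
    simpa using this.symm
  have h8 : φ (φ ξ) = η (φ ξ) • φ ξ := by
    conv_lhs => rw [h7]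
    rw [map_smul]
  rw [h3] at h8
  rcases smul_eq_zero.1 h8.symm with h9 | h9
  · rw [h9] at h7; exact hne (by simpa using h7)
  · exact hne h9

lemma g_ξ (h : IsAlmostContactMetric g φ ξ η) (X : E) : g X ξ = η X := by
  have := h.g_φ_φ X ξ
  rw [h.φ_ξ, h.η_ξ] at this
  simp at this
  linarith

lemma η_φ (h : IsAlmostContactMetric g φ ξ η) (X : E) : η (φ X) = 0 := by
  have h1 : φ (φ (φ X)) = -φ X := by
    rw [h.φ_φ X]; simp [h.φ_ξ]
  rw [h.φ_φ (φ X)] at h1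
  have h2 : η (φ X) • ξ = 0 := by
    have := congrArg (fun x => φ X + x) h1
    simpa using this
  have h3 := congrArg η h2
  simpa [h.η_ξ] using h3

lemma φ_skew (h : IsAlmostContactMetric g φ ξ η) (X Y : E) : g (φ X) Y = -g X (φ Y) := by
  have h1 := h.g_φ_φ (φ X) Y
  rw [h.φ_φ, h.η_φ] at h1
  have h2 : g ξ (φ Y) = 0 := by rw [h.symm, h.g_ξ, h.η_φ]
  simp [h2] at h1
  linarith

/-- The covariant derivatives `P = ∇φ` and `Q = ∇ξ` of a normal contact metric structure. -/
lemma covDeriv_of_normal (h : IsAlmostContactMetric g φ ξ η) (P : E → E → E) (Q : E → E)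
    (hφφ : ∀ X Y, P X (φ Y) + φ (P X Y) = g Y (Q X) • ξ + η Y • Q X)
    (hskew : ∀ X Y Z, g (P X Y) Z = -g (P X Z) Y)
    (hclosed : ∀ X Y Z, g (P X Y) Z + g (P Y Z) X + g (P Z X) Y = 0)
    (hN : ∀ X Y, P (φ X) Y - P (φ Y) X - φ (P X Y) + φ (P Y X) + (2 * g X (φ Y)) • ξ = 0)
    (hdη : ∀ X Y, g Y (Q X) - g X (Q Y) = 2 * g X (φ Y))
    (hξ : ∀ X, η (Q X) = 0) :
    (∀ X Y, P X Y = g X Y • ξ - η Y • X) ∧ ∀ X, Q X = -φ X := by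
  have hgξ' : ∀ X, g ξ X = η X := fun X => by rw [h.symm, h.g_ξ]
  have hPξ : ∀ X, P X ξ = -φ (Q X) := by
    intro X
    have h1 := congrArg φ (hφφ X ξ)
    -- `P` is a bare function, not assumed linear; skewness supplies this value.
    have h0 : P X 0 = 0 := by
      refine h.eq_of_inner fun Z => ?_
      rw [hskew]; simp
    rw [h.φ_ξ, h0, zero_add, h.φ_φ, h.η_ξ, hgξ', hξ] at h1
    have h2 : η (P X ξ) = 0 := by
      have := hskew X ξ ξ
      rw [h.g_ξ] at this; linarith
    rw [h2] at h1
    simp at h1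
    rw [← h1, neg_neg]
  have hPη : ∀ X Y, η (P X Y) = -g (φ Y) (Q X) := by
    intro X Y
    rw [← h.g_ξ, hskew, hPξ, h.symm]
    simp only [map_neg, neg_neg]
    rw [h.φ_skew]; ring
  -- The classical formula for `2g((∇_X φ)Y, Z)`: closedness at `(X, Y, Z)` and at `(X, φY, φZ)`,
  -- combined with normality at `(Y, Z)` paired with `φX`. Moving `φ` across `P` leaves terms in
  -- `Q`, which `hdη` turns into metric terms.
  have key : ∀ X Y Z, g (P X Y) Z = η Z * g X Y - η Y * g X Z := by
    intro X Y Z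
    have c1 : ∀ X Y Z, g (P X (φ Y)) Z - g (P X Y) (φ Z) = g Y (Q X) * η Z + η Y * g (Q X) Z := by
      intro X Y Z
      have := congrArg (fun v => g v Z) (hφφ X Y)
      simp [hgξ', h.φ_skew] at this
      linarith
    have n1 := congrArg (fun v => g v (φ X)) (hN Y Z)
    have n2 : g (φ (P Y Z)) (φ X) = g (P Y Z) X - η (P Y Z) * η X := h.g_φ_φ _ _
    have n3 : g (φ (P Z Y)) (φ X) = g (P Z Y) X - η (P Z Y) * η X := h.g_φ_φ _ _
    simp only [map_add, map_sub, map_smul, add_apply,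
      sub_apply, smul_apply, hgξ', h.η_φ, n2, n3,
      smul_zero, map_zero, zero_apply, hPη] at n1
    have a1 := c1 X Y (φ Z)
    have a2 := c1 (φ Y) Z X
    have a3 := c1 (φ Z) Y X
    rw [h.φ_φ Z, h.η_φ] at a1
    simp only [map_add, map_neg, map_smul, smul_eq_mul, h.g_ξ, hPη] at a1
    have b1 := hclosed X Y Z
    have b2 := hclosed X (φ Y) (φ Z)
    have b3 := hskew Z X Y
    have b4 := hskew (φ Z) X (φ Y)
    have d1 := hdη X (φ Y)
    have d2 := hdη X (φ Z)
    have d3 := hdη Z (φ Y)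
    have d4 := hdη Y (φ Z)
    rw [h.φ_φ] at d1 d2 d3 d4
    simp only [map_add, map_neg, map_smul, smul_eq_mul, h.g_ξ] at d1 d2 d3 d4
    have s1 := h.symm (Q X) (φ Z)
    have s2 := h.symm (Q (φ Z)) X
    have s3 := h.symm (Q (φ Y)) X
    have s4 := h.symm Z Y
    have e1 := congrArg (fun x => η Z * x) d1
    have e2 := congrArg (fun x => η Y * x) d2
    have e3 := congrArg (fun x => η X * x) d3
    have e4 := congrArg (fun x => η X * x) d4
    rw [s2] at a3
    rw [s3] at a2
    rw [s1] at a1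
    rw [s4] at e3
    simp only [mul_sub, mul_add] at e1 e2 e3 e4
    linarith
  have hP : ∀ X Y, P X Y = g X Y • ξ - η Y • X := by
    intro X Y
    refine h.eq_of_inner fun Z => ?_
    rw [key]
    simp [hgξ']; ring
  refine ⟨hP, fun X => ?_⟩
  have h1 := congrArg φ ((hPξ X).symm.trans (hP X ξ))
  rw [map_neg, h.φ_φ, hξ, h.η_ξ] at h1
  simpa [h.φ_ξ] using h1

end IsAlmostContactMetric

/-- A curvature-like tensor that is compatible with `φ`, vanishes on `ξ` and has zero
`φ`-sectional curvature has zero sectional curvature. -/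
lemma sectional_eq_zero_of_holomorphic {φ : E →L[ℝ] E} {ξ : E} {η : E →L[ℝ] ℝ}
    (hφφ : ∀ X, φ (φ X) = -X + η X • ξ) (B : E → E → E → E → ℝ)
    (hadd : ∀ X X' Y Z W, B (X + X') Y Z W = B X Y Z W + B X' Y Z W)
    (hsmul : ∀ (c : ℝ) X Y Z W, B (c • X) Y Z W = c * B X Y Z W)
    (h12 : ∀ X Y Z W, B X Y Z W = -B Y X Z W)
    (hpair : ∀ X Y Z W, B X Y Z W = B Z W X Y)
    (hbianchi : ∀ X Y Z W, B X Y Z W + B Y Z X W + B Z X Y W = 0)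
    (hφ : ∀ X Y Z W, B X Y (φ Z) W = -B X Y Z (φ W))
    (hξ : ∀ Y Z W, B ξ Y Z W = 0)
    (hhol : ∀ X, B X (φ X) (φ X) X = 0) (X Y W : E) : B X Y X W = 0 := by
  have hadd2 : ∀ X Y Y' Z W, B X (Y + Y') Z W = B X Y Z W + B X Y' Z W := by
    intro X Y Y' Z W
    rw [h12, hadd, h12 Y, h12 Y']; ring
  have hadd3 : ∀ X Y Z Z' W, B X Y (Z + Z') W = B X Y Z W + B X Y Z' W := by
    intro X Y Z Z' W
    rw [hpair, hadd, hpair Z, hpair Z']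
  have hadd4 : ∀ X Y Z W W', B X Y Z (W + W') = B X Y Z W + B X Y Z W' := by
    intro X Y Z W W'
    rw [hpair, hadd2, hpair Z, hpair Z]
  have hneg : ∀ X Y Z W, B (-X) Y Z W = -B X Y Z W := by
    intro X Y Z W
    have := hsmul (-1) X Y Z W
    simpa using this
  have hneg2 : ∀ X Y Z W, B X (-Y) Z W = -B X Y Z W := by
    intro X Y Z W; rw [h12, hneg, h12 Y]; ring
  have hneg3 : ∀ X Y Z W, B X Y (-Z) W = -B X Y Z W := by
    intro X Y Z W; rw [hpair, hneg, hpair Z]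
  have hneg4 : ∀ X Y Z W, B X Y Z (-W) = -B X Y Z W := by
    intro X Y Z W; rw [hpair, hneg2, hpair Z]
  have h34 : ∀ X Y Z W, B X Y Z W = -B X Y W Z := by
    intro X Y Z W; rw [hpair, h12, hpair W]
  have hφφ1 : ∀ X Y Z W, B (φ (φ X)) Y Z W = -B X Y Z W := by
    intro X Y Z W
    rw [hφφ, hadd, hneg, hsmul, hξ]; ring
  have hφφ2 : ∀ X Y Z W, B X (φ (φ Y)) Z W = -B X Y Z W := by
    intro X Y Z W; rw [h12, hφφ1, h12 Y]; ring
  have hφφ4 : ∀ X Y Z W, B X Y Z (φ (φ W)) = -B X Y Z W := by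
    intro X Y Z W; rw [hpair, hφφ2, hpair Z]
  -- Polarization: adding `hhol` at `X + Y` and at `X - Y` keeps the terms quadratic in each vector;
  -- the symmetries `a0`–`a6` reduce these to two quantities.
  have key : ∀ X Y, B X Y X Y + 3 * B X (φ Y) X (φ Y) = 0 := by
    intro X Y
    have e1 := hhol (X + Y)
    have e2 := hhol (X + -Y)
    simp only [map_add, map_neg, hadd, hadd2, hadd3, hadd4, hneg, hneg2, hneg3, hneg4, neg_neg,
      hhol] at e1 e2
    have a0 : B (φ X) Y (φ X) Y = B X (φ Y) X (φ Y) := by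
      rw [hφ, hpair, hφ, neg_neg]
    have a1 : B X (φ Y) (φ Y) X = -B X (φ Y) X (φ Y) := h34 _ _ _ _
    have a2 : B X (φ Y) (φ X) Y = -B X (φ Y) X (φ Y) := hφ _ _ _ _
    have a3 : B Y (φ X) (φ X) Y = -B X (φ Y) X (φ Y) := by rw [h12, a0]
    have a4 : B Y (φ X) (φ Y) X = -B X (φ Y) X (φ Y) := by
      rw [hφ, h12, h34, neg_neg, a0]
    have a5 : B X (φ X) (φ Y) Y = -B X Y X Y - B X (φ Y) X (φ Y) := by
      have b := hbianchi X (φ X) (φ Y) Y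
      have b1 : B (φ X) (φ Y) X Y = B X Y X Y := by
        rw [hpair, hφ, hφφ4, neg_neg]
      have b2 : B (φ Y) X (φ X) Y = B X (φ Y) X (φ Y) := by rw [h12, a2, neg_neg]
      linarith
    have a6 : B Y (φ Y) (φ X) X = B X (φ X) (φ Y) Y := by
      rw [hpair, h12, h34, neg_neg]
    linarith
  have hzero : ∀ X Y, B X Y X Y = 0 := by
    intro X Y
    -- Replacing `Y` by `φY` exchanges the two quantities, so `a + 3b = 0` and `b + 3a = 0`.
    have k1 := key X Y
    have k2 := key X (φ Y)
    rw [hφφ2, hφφ4] at k2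
    linarith
  -- Polarization in the second argument, with pair symmetry identifying the two mixed terms.
  have h1 := hzero X (Y + W)
  rw [hadd2, hadd4, hadd4, hzero, hzero, hpair X W] at h1
  linarith

/-- A curvature operator at a point of a Sasakian space form with constant `φ`-sectional
curvature `1`. -/
lemma IsAlmostContactMetric.curvature_eq {g : E →L[ℝ] E →L[ℝ] ℝ} {φ : E →L[ℝ] E} {ξ : E}
    {η : E →L[ℝ] ℝ} (h : IsAlmostContactMetric g φ ξ η) (R : E → E → E → E)
    (hadd : ∀ X X' Y Z, R (X + X') Y Z = R X Y Z + R X' Y Z)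
    (hsmul : ∀ (c : ℝ) X Y Z, R (c • X) Y Z = c • R X Y Z)
    (h12 : ∀ X Y Z, R X Y Z = -R Y X Z)
    (hbianchi : ∀ X Y Z, R X Y Z + R Y Z X + R Z X Y = 0)
    (hskew : ∀ X Y Z W, g (R X Y Z) W = -g (R X Y W) Z)
    (hφ : ∀ X Y Z, R X Y (φ Z) - φ (R X Y Z) =
      g (φ X) Z • Y - g Y Z • φ X + g X Z • φ Y - g (φ Y) Z • X)
    (hsec : ∀ X, g X X = 1 → g X ξ = 0 →
      g (R X (φ X) (φ X)) X / (g X X * g (φ X) (φ X) - g X (φ X) ^ 2) = 1)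
    {T X : E} (hT : g T T = 1) (hX : g T X = 0) : R T X T = -X := by
  -- The difference between `R` and the tensor `g(Y, Z)X - g(X, Z)Y` of constant curvature 1.
  set B : E → E → E → E → ℝ := fun X Y Z W => g (R X Y Z) W - g Y Z * g X W + g X Z * g Y W
    with hB
  have B12 : ∀ X Y Z W, B X Y Z W = -B Y X Z W := by
    intro X Y Z W
    simp only [hB]; rw [h12 X Y]; simp only [map_neg, neg_apply]; ring
  have B34 : ∀ X Y Z W, B X Y Z W = -B X Y W Z := by
    intro X Y Z W
    simp only [hB]; rw [hskew X Y]; ring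
  have Bbianchi : ∀ X Y Z W, B X Y Z W + B Y Z X W + B Z X Y W = 0 := by
    intro X Y Z W
    have := congrArg (fun v => g v W) (hbianchi X Y Z)
    simp only [map_add, add_apply, map_zero, zero_apply] at this
    simp only [hB]
    rw [h.symm Z X, h.symm Z Y, h.symm Y X]
    linarith
  have Bpair : ∀ X Y Z W, B X Y Z W = B Z W X Y := by
    intro X Y Z W
    -- Pair symmetry is the usual consequence of four cyclic Bianchi identities and the two skew
    -- symmetries.
    have e1 := Bbianchi X Y Z W
    have e2 := Bbianchi Y Z W X
    have e3 := Bbianchi Z W X Y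
    have e4 := Bbianchi W X Y Z
    have f1 := B34 Y Z X W
    have f2 := B34 Z W Y X
    have f3 := B34 W X Z Y
    have f4 := B34 X Y W Z
    have f5 := B12 Z X Y W
    have f6 := B34 X Z Y W
    have f7 := B12 W Y Z X
    have f8 := B34 Y W Z X
    have f9 := B34 Z X W Y
    have f10 := B12 X W Y Z
    have f11 := B34 W Y X Z
    linarith
  have Bφ : ∀ X Y Z W, B X Y (φ Z) W = -B X Y Z (φ W) := by
    intro X Y Z W
    have e := congrArg (fun v => g v W) (hφ X Y Z)
    simp only [map_add, map_sub, map_smul, add_apply, sub_apply, smul_apply, smul_eq_mul,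
      h.φ_skew] at e
    simp only [hB]
    linarith
  have Badd : ∀ X X' Y Z W, B (X + X') Y Z W = B X Y Z W + B X' Y Z W := by
    intro X X' Y Z W
    simp only [hB, hadd, map_add, add_apply]; ring
  have Bsmul : ∀ (c : ℝ) X Y Z W, B (c • X) Y Z W = c * B X Y Z W := by
    intro c X Y Z W
    simp only [hB, hsmul, map_smul, smul_apply, smul_eq_mul]; ring
  have Bξ3 : ∀ X Y W, B X Y ξ W = 0 := by
    intro X Y W
    have e1 := B34 X Y ξ ξ
    -- Because `φξ = 0`, compatibility gives `B(X, Y, ξ, φ²W) = 0`. Here `φ²W = -W + η(W)ξ`, and the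
    -- `ξ` part contributes nothing by skewness.
    have e2 := Bφ X Y ξ (φ W)
    have h0 : B X Y 0 (φ W) = 0 := by
      rw [Bpair, ← zero_smul ℝ ξ, Bsmul, zero_mul]
    rw [h.φ_ξ, h0, h.φ_φ, Bpair, B12, Badd, Bsmul, B12 ξ ξ] at e2
    have e3 : B (-W) ξ X Y = -B W ξ X Y := by simpa using Bsmul (-1) W ξ X Y
    have e4 := Bpair X Y ξ W
    have e5 := B12 ξ W X Y
    have e6 := B12 ξ ξ X Y
    have e7 : B ξ ξ X Y = 0 := by linarith
    rw [e3, e7] at e2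
    linarith
  have Bξ : ∀ Y Z W, B ξ Y Z W = 0 := fun Y Z W => by rw [Bpair, Bξ3]
  have Bhol : ∀ X, B X (φ X) (φ X) X = 0 := by
    have hunit : ∀ X, g X X = 1 → η X = 0 → B X (φ X) (φ X) X = 0 := by
      intro X h1 h2
      have e := hsec X h1 (by rw [h.g_ξ, h2])
      have e2 : g X (φ X) = 0 := by
        have := h.φ_skew X X
        rw [h.symm (φ X)] at this; linarith
      have e3 := h.g_φ_φ X X
      rw [h1, h2] at e3
      rw [h1, e3, e2] at e
      simp only [hB]
      rw [h1, e3, e2]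
      norm_num at e ⊢
      linarith
    -- Passage from unit to arbitrary horizontal vectors by scaling. Afterwards the `ξ` component of
    -- a general vector is removed, as both `B` and `φ` vanish on it.
    have hhor : ∀ X, η X = 0 → B X (φ X) (φ X) X = 0 := by
      intro X hX
      by_cases hX0 : X = 0
      · subst hX0
        rw [← zero_smul ℝ ξ, Bsmul, zero_mul]
      have hp := h.pos X hX0
      set c := (Real.sqrt (g X X))⁻¹ with hc
      have hs : Real.sqrt (g X X) ≠ 0 := (Real.sqrt_pos.2 hp).ne'
      have hcc : c * c * g X X = 1 := by
        rw [hc, ← Real.mul_self_sqrt hp.le]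
        simp only [Real.sqrt_mul_self (Real.sqrt_nonneg _)]
        field_simp
      have hc0 : c ≠ 0 := inv_ne_zero hs
      have := hunit (c • X) (by simp only [map_smul, smul_apply, smul_eq_mul]; linarith)
        (by simp [hX])
      rw [map_smul, Bsmul, B12, Bsmul, Bpair, Bsmul, B12, Bsmul, B12] at this
      have h4 : B X (φ X) (φ X) X = B (φ X) X X (φ X) := by rw [Bpair]
      rw [h4, B34]
      simpa [hc0] using this
    intro X
    have h1 := hhor (X + (-η X) • ξ) (by simp [h.η_ξ])
    rw [map_add, map_smul, h.φ_ξ, smul_zero, add_zero, Badd, Bsmul, Bξ, B34, Bpair, Badd, Bsmul,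
      Bξ] at h1
    rw [B34, Bpair]
    linarith
  have hz := sectional_eq_zero_of_holomorphic h.φ_φ B Badd Bsmul B12 Bpair Bbianchi Bφ Bξ Bhol
  refine h.eq_of_inner fun W => ?_
  have := hz T X W
  simp only [hB] at this
  rw [h.symm X T, hX, hT] at this
  simp only [map_neg, neg_apply]
  linarith

end PointwiseAlgebra

/-! ### Levi-Civita connections and Sasakian structures on an open subset of a normed space. -/

section LocalCalculus

open Filter Topology

variable {E F : Type*} [NormedAddCommGroup E] [NormedSpace ℝ E]
  [NormedAddCommGroup F] [NormedSpace ℝ F]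

/-- Pointwise identities between tensors are differentiated below by restricting both sides to a
line `t ↦ y + t • X` and using uniqueness of the derivative at `0`. -/
lemma DifferentiableAt.hasDerivAt_line {f : E → F} {y : E} (hf : DifferentiableAt ℝ f y) (X : E) :
    HasDerivAt (fun t : ℝ => f (y + t • X)) (fderiv ℝ f y X) 0 := by
  have h : HasDerivAt (fun t : ℝ => y + t • X) X 0 := by
    simpa using ((hasDerivAt_id (0 : ℝ)).smul_const X).const_add y
  have hf' : HasFDerivAt f (fderiv ℝ f y) (y + (0 : ℝ) • X) := by simpa using hf.hasFDerivAt
  exact hf'.comp_hasDerivAt 0 h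

lemma tendsto_line (y X : E) : Tendsto (fun t : ℝ => y + t • X) (𝓝 0) (𝓝 y) := by
  have : Continuous fun t : ℝ => y + t • X := by fun_prop
  simpa using this.tendsto 0

lemma DifferentiableAt.hasDerivAt_line_apply {A : E → E →L[ℝ] F} {y : E}
    (hA : DifferentiableAt ℝ A y) (X : E) {b : ℝ → E} {b₀ b' : E} (hb : HasDerivAt b b' 0)
    (hb₀ : b 0 = b₀) :
    HasDerivAt (fun t : ℝ => A (y + t • X) (b t)) (fderiv ℝ A y X b₀ + A y b') 0 := by
  have h := (hA.hasDerivAt_line X).clm_apply hb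
  simp only [zero_smul, add_zero, hb₀] at h
  exact h

lemma DifferentiableAt.hasDerivAt_line_apply_const {A : E → E →L[ℝ] F} {y : E}
    (hA : DifferentiableAt ℝ A y) (X v : E) :
    HasDerivAt (fun t : ℝ => A (y + t • X) v) (fderiv ℝ A y X v) 0 := by
  have h := hA.hasDerivAt_line_apply X (hasDerivAt_const (0 : ℝ) v) rfl
  simp only [map_zero, add_zero] at h
  exact h

lemma DifferentiableAt.hasDerivAt_line_apply_apply {A : E → E →L[ℝ] E →L[ℝ] F} {y : E}
    (hA : DifferentiableAt ℝ A y) (X : E) {b c : ℝ → E} {b₀ b' c₀ c' : E}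
    (hb : HasDerivAt b b' 0) (hb₀ : b 0 = b₀) (hc : HasDerivAt c c' 0) (hc₀ : c 0 = c₀) :
    HasDerivAt (fun t : ℝ => A (y + t • X) (b t) (c t))
      (fderiv ℝ A y X b₀ c₀ + A y b' c₀ + A y b₀ c') 0 := by
  have h := (hA.hasDerivAt_line_apply X hb hb₀).clm_apply hc
  simp only [zero_smul, add_zero, hb₀, hc₀, add_apply] at h
  exact h

lemma DifferentiableAt.hasDerivAt_line_apply_const_apply {A : E → E →L[ℝ] E →L[ℝ] F} {y : E}
    (hA : DifferentiableAt ℝ A y) (X v : E) {c : ℝ → E} {c₀ c' : E} (hc : HasDerivAt c c' 0)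
    (hc₀ : c 0 = c₀) : HasDerivAt (fun t : ℝ => A (y + t • X) v (c t))
      (fderiv ℝ A y X v c₀ + A y v c') 0 := by
  have h := hA.hasDerivAt_line_apply_apply X (hasDerivAt_const (0 : ℝ) v) rfl hc hc₀
  simp only [map_zero, add_zero, zero_apply] at h
  exact h

lemma DifferentiableAt.hasDerivAt_line_apply_apply_const {A : E → E →L[ℝ] E →L[ℝ] F} {y : E}
    (hA : DifferentiableAt ℝ A y) (X v : E) {b : ℝ → E} {b₀ b' : E} (hb : HasDerivAt b b' 0)
    (hb₀ : b 0 = b₀) : HasDerivAt (fun t : ℝ => A (y + t • X) (b t) v)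
      (fderiv ℝ A y X b₀ v + A y b' v) 0 := by
  have h := hA.hasDerivAt_line_apply_apply X hb hb₀ (hasDerivAt_const (0 : ℝ) v) rfl
  simp only [map_zero, add_zero] at h
  exact h

lemma DifferentiableAt.hasDerivAt_line_apply_const_const {A : E → E →L[ℝ] E →L[ℝ] F} {y : E}
    (hA : DifferentiableAt ℝ A y) (X u v : E) :
    HasDerivAt (fun t : ℝ => A (y + t • X) u v) (fderiv ℝ A y X u v) 0 := by
  have h := hA.hasDerivAt_line_apply_const_apply X u (hasDerivAt_const (0 : ℝ) v) rfl
  simp only [map_zero, add_zero] at h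
  exact h

/-- Symmetry of second derivatives, for a function whose first derivatives are given by `A`. -/
lemma ContDiffAt.deriv_line_comm {f : E → F} {y : E} (hf : ContDiffAt ℝ 2 f y) {A : E → E → F}
    (hA : ∀ᶠ z in 𝓝 y, ∀ u, fderiv ℝ f z u = A z u) {X Y : E} {a b : F}
    (ha : HasDerivAt (fun t : ℝ => A (y + t • X) Y) a 0)
    (hb : HasDerivAt (fun t : ℝ => A (y + t • Y) X) b 0) : a = b := by
  have hd : DifferentiableAt ℝ (fderiv ℝ f) y :=
    (hf.fderiv_right (m := 1) le_rfl).differentiableAt one_ne_zero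
  have key : ∀ {X Y : E} {a : F}, HasDerivAt (fun t : ℝ => A (y + t • X) Y) a 0 →
      a = fderiv ℝ (fderiv ℝ f) y X Y := by
    intro X Y a ha
    have h1 := hd.hasDerivAt_line_apply_const X Y
    refine ha.unique (h1.congr_of_eventuallyEq ?_)
    filter_upwards [(tendsto_line y X).eventually hA] with t ht using (ht Y).symm
  rw [key ha, key hb, (hf.isSymmSndFDerivAt (by simp)).eq]

/-- `Γ` is the Levi-Civita connection of the metric `G` on the open set `U`: it is torsion free and
`G` is parallel. -/
structure IsLocalLeviCivita (U : Set E) (G : E → E →L[ℝ] E →L[ℝ] ℝ)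
    (Γ : E → E →L[ℝ] E →L[ℝ] E) : Prop where
  isOpen : IsOpen U
  smooth_metric : ContDiffOn ℝ ∞ G U
  smooth_connection : ContDiffOn ℝ ∞ Γ U
  symm : ∀ y ∈ U, ∀ u v, G y u v = G y v u
  nondeg : ∀ y ∈ U, ∀ u v, (∀ w, G y u w = G y v w) → u = v
  torsion : ∀ y ∈ U, ∀ u v, Γ y u v = Γ y v u
  parallel : ∀ y ∈ U, ∀ w u v, fderiv ℝ G y w u v = G y (Γ y w u) v + G y u (Γ y w v)

/-- The curvature operator of the connection `Γ`. -/
def localCurvature (Γ : E → E →L[ℝ] E →L[ℝ] E) (y X Y Z : E) : E :=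
  fderiv ℝ Γ y X Y Z - fderiv ℝ Γ y Y X Z + Γ y X (Γ y Y Z) - Γ y Y (Γ y X Z)

lemma ContDiffOn.differentiableAt_of_isOpen {f : E → F} {U : Set E} (hf : ContDiffOn ℝ ∞ f U)
    (hU : IsOpen U) {y : E} (hy : y ∈ U) : DifferentiableAt ℝ f y :=
  (hf.contDiffAt (hU.mem_nhds hy)).differentiableAt (by simp)

namespace IsLocalLeviCivita

variable {U : Set E} {G : E → E →L[ℝ] E →L[ℝ] ℝ} {Γ : E → E →L[ℝ] E →L[ℝ] E}

lemma fderiv_connection_symm (h : IsLocalLeviCivita U G Γ) {y : E} (hy : y ∈ U) (X Y Z : E) :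
    fderiv ℝ Γ y X Y Z = fderiv ℝ Γ y X Z Y := by
  have hd := h.smooth_connection.differentiableAt_of_isOpen h.isOpen hy
  refine (hd.hasDerivAt_line_apply_const_const X Y Z).unique
    ((hd.hasDerivAt_line_apply_const_const X Z Y).congr_of_eventuallyEq ?_)
  filter_upwards [(tendsto_line y X).eventually (h.isOpen.mem_nhds hy)] with t ht
    using h.torsion _ ht _ _

lemma bianchi (h : IsLocalLeviCivita U G Γ) {y : E} (hy : y ∈ U) (X Y Z : E) :
    localCurvature Γ y X Y Z + localCurvature Γ y Y Z X + localCurvature Γ y Z X Y = 0 := by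
  simp only [localCurvature]
  rw [h.fderiv_connection_symm hy X Z Y, h.fderiv_connection_symm hy Y Z X,
    h.fderiv_connection_symm hy Z Y X, h.torsion y hy Z Y, h.torsion y hy Z X,
    h.torsion y hy Y X]
  abel

/-- For constant `Z, W`, parallelism of `G` expresses the first derivatives of `G(Z, W)` through
`Γ`. Antisymmetrizing the second derivatives leaves `G(R(X, Y)Z, W) + G(Z, R(X, Y)W)`, which must be
zero. -/
lemma curvature_skew (h : IsLocalLeviCivita U G Γ) {y : E} (hy : y ∈ U) (X Y Z W : E) :
    G y (localCurvature Γ y X Y Z) W = -G y (localCurvature Γ y X Y W) Z := by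
  have hG := h.smooth_metric.differentiableAt_of_isOpen h.isOpen hy
  have hΓ := h.smooth_connection.differentiableAt_of_isOpen h.isOpen hy
  have hf : ContDiffAt ℝ 2 (fun z => G z Z W) y :=
    (((h.smooth_metric.contDiffAt (h.isOpen.mem_nhds hy)).of_le (by norm_cast)).clm_apply
      contDiffAt_const).clm_apply contDiffAt_const
  have hA : ∀ᶠ z in 𝓝 y, ∀ u, fderiv ℝ (fun z => G z Z W) z u
      = G z (Γ z u Z) W + G z Z (Γ z u W) := by
    filter_upwards [h.isOpen.mem_nhds hy] with z hz u
    have hd := (h.smooth_metric.differentiableAt_of_isOpen h.isOpen hz)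
    rw [← h.parallel z hz]
    have hd' : DifferentiableAt ℝ (fun z => G z Z W) z :=
      (hd.clm_apply (differentiableAt_const Z)).clm_apply (differentiableAt_const W)
    exact (hd'.hasDerivAt_line u).unique (hd.hasDerivAt_line_apply_const_const u Z W)
  have hder : ∀ X Y, HasDerivAt (fun t : ℝ => G (y + t • X) (Γ (y + t • X) Y Z) W
        + G (y + t • X) Z (Γ (y + t • X) Y W))
      (fderiv ℝ G y X (Γ y Y Z) W + G y (fderiv ℝ Γ y X Y Z) W +
        (fderiv ℝ G y X Z (Γ y Y W) + G y Z (fderiv ℝ Γ y X Y W))) 0 := by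
    intro X Y
    exact (hG.hasDerivAt_line_apply_apply_const X W
      (hΓ.hasDerivAt_line_apply_const_const X Y Z) (by simp)).add
      (hG.hasDerivAt_line_apply_const_apply X Z
        (hΓ.hasDerivAt_line_apply_const_const X Y W) (by simp))
  have key := hf.deriv_line_comm hA (hder X Y) (hder Y X)
  simp only [h.parallel y hy] at key
  simp only [localCurvature, map_add, map_sub, add_apply, sub_apply]
  have s := h.symm y hy
  rw [s _ Z, s _ Z, s _ Z, s _ Z]
  linarith

end IsLocalLeviCivita

/-- A Sasakian structure in coordinates on the open set `U`. -/
structure IsLocalSasakian (U : Set E) (G : E → E →L[ℝ] E →L[ℝ] ℝ) (Γ : E → E →L[ℝ] E →L[ℝ] E)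
    (Φ : E → E →L[ℝ] E) (Ξ : E → E) (H : E → E →L[ℝ] ℝ) : Prop
    extends IsLocalLeviCivita U G Γ where
  smooth_Φ : ContDiffOn ℝ ∞ Φ U
  smooth_Ξ : ContDiffOn ℝ ∞ Ξ U
  smooth_H : ContDiffOn ℝ ∞ H U
  almostContact : ∀ y ∈ U, IsAlmostContactMetric (G y) (Φ y) (Ξ y) (H y)
  contact : ∀ y ∈ U, ∀ u v, 2 * G y u (Φ y v) = fderiv ℝ H y u v - fderiv ℝ H y v u
  normal : ∀ y ∈ U, ∀ u v, fderiv ℝ Φ y (Φ y u) v - fderiv ℝ Φ y (Φ y v) u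
    + Φ y (fderiv ℝ Φ y v u) - Φ y (fderiv ℝ Φ y u v) + (2 * G y u (Φ y v)) • Ξ y = 0

namespace IsLocalSasakian

variable {U : Set E} {G : E → E →L[ℝ] E →L[ℝ] ℝ} {Γ : E → E →L[ℝ] E →L[ℝ] E}
  {Φ : E → E →L[ℝ] E} {Ξ : E → E} {H : E → E →L[ℝ] ℝ}

/-- The form `η` is the metric dual of `ξ`; the derivative of this identity. -/
lemma fderiv_form (h : IsLocalSasakian U G Γ Φ Ξ H) {y : E} (hy : y ∈ U) (X Y : E) :
    fderiv ℝ H y X Y = G y Y (fderiv ℝ Ξ y X + Γ y X (Ξ y)) + H y (Γ y X Y) := by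
  have hG := h.smooth_metric.differentiableAt_of_isOpen h.isOpen hy
  have hH := h.smooth_H.differentiableAt_of_isOpen h.isOpen hy
  have hΞ := (h.smooth_Ξ.differentiableAt_of_isOpen h.isOpen hy).hasDerivAt_line X
  have h1 := hH.hasDerivAt_line_apply_const X Y
  have h2 := hG.hasDerivAt_line_apply_const_apply X Y hΞ rfl
  simp only [zero_smul, add_zero] at h2
  have h3 := h1.unique (h2.congr_of_eventuallyEq (by
    filter_upwards [(tendsto_line y X).eventually (h.isOpen.mem_nhds hy)] with t ht
    exact ((h.almostContact _ ht).g_ξ _).symm))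
  rw [h3, h.parallel y hy, map_add, (h.almostContact y hy).g_ξ]
  ring

/-- This lemma and the next three differentiate the pointwise identities of the structure. Rewritten
with `Γ`, these derivatives become the hypotheses of `covDeriv_of_normal`. -/
lemma φ_skew_fderiv (h : IsLocalSasakian U G Γ Φ Ξ H) {y : E} (hy : y ∈ U) (X Y Z : E) :
    fderiv ℝ G y X (Φ y Y) Z + G y (fderiv ℝ Φ y X Y) Z
      = -(fderiv ℝ G y X Y (Φ y Z) + G y Y (fderiv ℝ Φ y X Z)) := by
  have hG := h.smooth_metric.differentiableAt_of_isOpen h.isOpen hy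
  have hΦ := h.smooth_Φ.differentiableAt_of_isOpen h.isOpen hy
  have h1 := hG.hasDerivAt_line_apply_apply_const X Z (hΦ.hasDerivAt_line_apply_const X Y) rfl
  have h2 := (hG.hasDerivAt_line_apply_const_apply X Y
    (hΦ.hasDerivAt_line_apply_const X Z) rfl).neg
  simp only [zero_smul, add_zero] at h1 h2
  refine h1.unique (h2.congr_of_eventuallyEq ?_)
  filter_upwards [(tendsto_line y X).eventually (h.isOpen.mem_nhds hy)] with t ht
    using (h.almostContact _ ht).φ_skew _ _

lemma φ_φ_fderiv (h : IsLocalSasakian U G Γ Φ Ξ H) {y : E} (hy : y ∈ U) (X Y : E) :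
    fderiv ℝ Φ y X (Φ y Y) + Φ y (fderiv ℝ Φ y X Y)
      = H y Y • fderiv ℝ Ξ y X + fderiv ℝ H y X Y • Ξ y := by
  have hH := h.smooth_H.differentiableAt_of_isOpen h.isOpen hy
  have hΞ := (h.smooth_Ξ.differentiableAt_of_isOpen h.isOpen hy).hasDerivAt_line X
  have hΦ := h.smooth_Φ.differentiableAt_of_isOpen h.isOpen hy
  have h1 := hΦ.hasDerivAt_line_apply X (hΦ.hasDerivAt_line_apply_const X Y) rfl
  have h2 := ((hH.hasDerivAt_line_apply_const X Y).smul hΞ).const_add (-Y)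
  simp only [add_zero, zero_smul] at h1 h2
  refine h1.unique (h2.congr_of_eventuallyEq ?_)
  filter_upwards [(tendsto_line y X).eventually (h.isOpen.mem_nhds hy)] with t ht
    using (h.almostContact _ ht).φ_φ _

lemma ξ_unit_fderiv (h : IsLocalSasakian U G Γ Φ Ξ H) {y : E} (hy : y ∈ U) (X : E) :
    fderiv ℝ G y X (Ξ y) (Ξ y) + G y (fderiv ℝ Ξ y X) (Ξ y)
      + G y (Ξ y) (fderiv ℝ Ξ y X) = 0 := by
  have hG := h.smooth_metric.differentiableAt_of_isOpen h.isOpen hy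
  have hΞ := (h.smooth_Ξ.differentiableAt_of_isOpen h.isOpen hy).hasDerivAt_line X
  have h1 := hG.hasDerivAt_line_apply_apply X hΞ rfl hΞ rfl
  simp only [zero_smul, add_zero] at h1
  refine h1.unique ((hasDerivAt_const (0 : ℝ) (1 : ℝ)).congr_of_eventuallyEq ?_)
  filter_upwards [(tendsto_line y X).eventually (h.isOpen.mem_nhds hy)] with t ht
  rw [(h.almostContact _ ht).g_ξ, (h.almostContact _ ht).η_ξ]

lemma contact_fderiv (h : IsLocalSasakian U G Γ Φ Ξ H) {y : E} (hy : y ∈ U) (X Y Z : E) :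
    2 * (fderiv ℝ G y X Y (Φ y Z) + G y Y (fderiv ℝ Φ y X Z))
      = fderiv ℝ (fderiv ℝ H) y X Y Z - fderiv ℝ (fderiv ℝ H) y X Z Y := by
  have hG := h.smooth_metric.differentiableAt_of_isOpen h.isOpen hy
  have hΦ := h.smooth_Φ.differentiableAt_of_isOpen h.isOpen hy
  have hd2 : DifferentiableAt ℝ (fderiv ℝ H) y :=
    ((h.smooth_H.contDiffAt (h.isOpen.mem_nhds hy)).fderiv_right (m := 1)
      (by norm_cast)).differentiableAt one_ne_zero
  have hS := hd2.hasDerivAt_line_apply_const_const X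
  have h1 := (hG.hasDerivAt_line_apply_const_apply X Y
    (hΦ.hasDerivAt_line_apply_const X Z) rfl).const_mul 2
  simp only [add_zero, zero_smul] at h1
  refine h1.unique (((hS Y Z).sub (hS Z Y)).congr_of_eventuallyEq ?_)
  filter_upwards [(tendsto_line y X).eventually (h.isOpen.mem_nhds hy)] with t ht
    using h.contact _ ht _ _

/-- The fundamental `2`-form is closed. -/
lemma fundamentalForm_closed (h : IsLocalSasakian U G Γ Φ Ξ H) {y : E} (hy : y ∈ U)
    (X Y Z : E) : (fderiv ℝ G y X Y (Φ y Z) + G y Y (fderiv ℝ Φ y X Z))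
      + (fderiv ℝ G y Y Z (Φ y X) + G y Z (fderiv ℝ Φ y Y X))
      + (fderiv ℝ G y Z X (Φ y Y) + G y X (fderiv ℝ Φ y Z Y)) = 0 := by
  -- The fundamental form is `dη`, so its closedness is `d² = 0`, the symmetry of the second
  -- derivative of `H`.
  have hsym := (h.smooth_H.contDiffAt (h.isOpen.mem_nhds hy)).isSymmSndFDerivAt
    (by simp; norm_cast)
  have e1 := h.contact_fderiv hy X Y Z
  have e2 := h.contact_fderiv hy Y Z X
  have e3 := h.contact_fderiv hy Z X Y
  rw [hsym.eq X Z] at e1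
  rw [hsym.eq Y X] at e2
  rw [hsym.eq Z Y] at e3
  linarith

/-- In a Sasakian manifold `(∇_X φ) Y = g(X, Y) ξ - η(Y) X` and `∇_X ξ = -φ X`. -/
lemma covDeriv (h : IsLocalSasakian U G Γ Φ Ξ H) {y : E} (hy : y ∈ U) :
    (∀ X Y, fderiv ℝ Φ y X Y + Γ y X (Φ y Y) - Φ y (Γ y X Y) = G y X Y • Ξ y - H y Y • X) ∧
      ∀ X, fderiv ℝ Ξ y X + Γ y X (Ξ y) = -Φ y X := by
  have ha := h.almostContact y hy
  have dskew := h.φ_skew_fderiv hy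
  have dφφ := h.φ_φ_fderiv hy
  have dξ := h.ξ_unit_fderiv hy
  have dF := h.fundamentalForm_closed hy
  have par := h.parallel y hy
  have sym := h.symm y hy
  have tor := h.torsion y hy
  have skew := ha.φ_skew
  refine ha.covDeriv_of_normal
    (fun X Y => fderiv ℝ Φ y X Y + Γ y X (Φ y Y) - Φ y (Γ y X Y))
    (fun X => fderiv ℝ Ξ y X + Γ y X (Ξ y)) ?_ ?_ ?_ ?_ ?_ ?_
  · intro X Y
    have e := dφφ X Y
    rw [h.fderiv_form hy X Y] at e
    simp only [map_add, map_sub, ha.φ_φ, map_neg, map_smul] at e ⊢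
    have e' := eq_sub_of_add_eq e
    rw [e']
    module
  · intro X Y Z
    have e := dskew X Y Z
    simp only [par] at e
    simp only [map_add, map_sub, add_apply, sub_apply]
    have s1 := skew (Γ y X Y) Z
    have s2 := sym (Γ y X (Φ y Z)) Y
    have s3 := sym (fderiv ℝ Φ y X Z) Y
    have s4 := sym (Φ y (Γ y X Z)) Y
    have s5 := skew Y (Γ y X Z)
    linarith
  · intro X Y Z
    have e := dF X Y Z
    simp only [par] at e
    simp only [map_add, map_sub, add_apply, sub_apply]
    have t1 : ∀ A B C, G y (Φ y (Γ y A B)) C = -G y (Γ y A B) (Φ y C) := fun A B C => skew _ _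
    have d1 := dskew X Y Z
    have d2 := dskew Y Z X
    have d3 := dskew Z X Y
    simp only [par] at d1 d2 d3
    simp only [t1]
    have s1 := sym (Γ y Y X) (Φ y Z)
    have u1 := skew X (Γ y Y Z)
    have u2 := skew Y (Γ y Z X)
    have u3 := skew Z (Γ y X Y)
    have w1 := sym (Φ y X) (Γ y Y Z)
    have w2 := sym (Φ y Y) (Γ y Z X)
    have w3 := sym (Φ y Z) (Γ y X Y)
    rw [tor Y X, tor Z Y] at *
    rw [tor X Z] at *
    linarith
  -- Normality is given with partial derivatives. Passing to covariant ones adds Christoffel terms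
  -- that cancel because the connection is torsion free.
  · intro X Y
    have e := h.normal y hy X Y
    simp only [map_add, map_sub]
    rw [tor (Φ y Y) X, tor (Φ y X) Y, tor (Φ y X) (Φ y Y), tor Y X]
    rw [← e]
    abel
  · intro X Y
    have e := h.contact y hy X Y
    rw [h.fderiv_form hy, h.fderiv_form hy, tor Y X] at e
    linarith
  · intro X
    have e := dξ X
    rw [par] at e
    rw [← ha.g_ξ, map_add, add_apply]
    have s1 := sym (fderiv ℝ Ξ y X) (Ξ y)
    have s2 := sym (Γ y X (Ξ y)) (Ξ y)
    linarith

/-- The Ricci identity for `φ` in a Sasakian manifold. -/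
lemma curvature_comm_φ (h : IsLocalSasakian U G Γ Φ Ξ H) {y : E} (hy : y ∈ U) (X Y Z : E) :
    localCurvature Γ y X Y (Φ y Z) - Φ y (localCurvature Γ y X Y Z) =
      G y (Φ y X) Z • Y - G y Y Z • Φ y X + G y X Z • Φ y Y - G y (Φ y Y) Z • X := by
  have ha := h.almostContact y hy
  have hG := h.smooth_metric.differentiableAt_of_isOpen h.isOpen hy
  have hH := h.smooth_H.differentiableAt_of_isOpen h.isOpen hy
  have hΞ := (h.smooth_Ξ.differentiableAt_of_isOpen h.isOpen hy).hasDerivAt_line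
  have hΦ := h.smooth_Φ.differentiableAt_of_isOpen h.isOpen hy
  have hΓ := h.smooth_connection.differentiableAt_of_isOpen h.isOpen hy
  have hf : ContDiffAt ℝ 2 (fun z => Φ z Z) y :=
    ((h.smooth_Φ.contDiffAt (h.isOpen.mem_nhds hy)).of_le (by norm_cast)).clm_apply
      contDiffAt_const
  -- The formula for `∇φ` holds on all of `U`, so it can be differentiated again. Symmetry of the
  -- resulting second derivatives of `Φ` is the Ricci identity.
  have hA : ∀ᶠ z in 𝓝 y, ∀ u, fderiv ℝ (fun z => Φ z Z) z u
      = G z u Z • Ξ z - H z Z • u + Φ z (Γ z u Z) - Γ z u (Φ z Z) := by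
    filter_upwards [h.isOpen.mem_nhds hy] with z hz u
    have hd := h.smooth_Φ.differentiableAt_of_isOpen h.isOpen hz
    have hd' : DifferentiableAt ℝ (fun z => Φ z Z) z := hd.clm_apply (differentiableAt_const Z)
    rw [← (h.covDeriv hz).1, (hd'.hasDerivAt_line u).unique (hd.hasDerivAt_line_apply_const u Z)]
    abel
  have hder : ∀ X Y, HasDerivAt (fun t : ℝ => G (y + t • X) Y Z • Ξ (y + t • X)
      - H (y + t • X) Z • Y + Φ (y + t • X) (Γ (y + t • X) Y Z)
      - Γ (y + t • X) Y (Φ (y + t • X) Z))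
      (G y Y Z • fderiv ℝ Ξ y X + fderiv ℝ G y X Y Z • Ξ y - fderiv ℝ H y X Z • Y
        + (fderiv ℝ Φ y X (Γ y Y Z) + Φ y (fderiv ℝ Γ y X Y Z))
        - (fderiv ℝ Γ y X Y (Φ y Z) + Γ y Y (fderiv ℝ Φ y X Z))) 0 := by
    intro X Y
    have h1 := ((((hG.hasDerivAt_line_apply_const_const X Y Z).smul (hΞ X)).sub
      ((hH.hasDerivAt_line_apply_const X Z).smul_const Y)).add
      (hΦ.hasDerivAt_line_apply X (hΓ.hasDerivAt_line_apply_const_const X Y Z) rfl)).sub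
      (hΓ.hasDerivAt_line_apply_const_apply X Y (hΦ.hasDerivAt_line_apply_const X Z) rfl)
    simp only [add_zero, zero_smul] at h1
    exact h1
  have key := hf.deriv_line_comm hA (hder X Y) (hder Y X)
  have dΞ : ∀ X, fderiv ℝ Ξ y X = -Φ y X - Γ y X (Ξ y) := fun X =>
    eq_sub_of_add_eq ((h.covDeriv hy).2 X)
  have dΦ : ∀ X Y, fderiv ℝ Φ y X Y
      = G y X Y • Ξ y - H y Y • X + Φ y (Γ y X Y) - Γ y X (Φ y Y) := by
    intro X Y
    rw [← (h.covDeriv hy).1]; abel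
  have dH : ∀ X, fderiv ℝ H y X Z = G y (Φ y X) Z * (-1) + H y (Γ y X Z) := by
    intro X
    rw [h.fderiv_form hy, (h.covDeriv hy).2, map_neg, h.symm y hy Z]
    ring
  simp only [dΞ, dΦ, dH, h.parallel y hy, map_add, map_sub, map_smul] at key
  simp only [localCurvature, map_add, map_sub]
  rw [h.torsion y hy Y X] at key
  rw [← sub_eq_zero] at key ⊢
  rw [← neg_eq_zero, ← key]
  module

lemma curvature_eq (h : IsLocalSasakian U G Γ Φ Ξ H) {y : E} (hy : y ∈ U)
    (hsec : ∀ X, G y X X = 1 → G y X (Ξ y) = 0 →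
      G y (localCurvature Γ y X (Φ y X) (Φ y X)) X /
        (G y X X * G y (Φ y X) (Φ y X) - G y X (Φ y X) ^ 2) = 1)
    {T X : E} (hT : G y T T = 1) (hX : G y T X = 0) : localCurvature Γ y T X T = -X := by
  refine (h.almostContact y hy).curvature_eq (localCurvature Γ y) ?_ ?_ ?_
    (h.bianchi hy) (h.curvature_skew hy) (h.curvature_comm_φ hy) hsec hT hX
  · intro X X' Y Z
    simp only [localCurvature, (fderiv ℝ Γ y).map_add X X', (fderiv ℝ Γ y Y).map_add X X',
      (Γ y).map_add X X', (Γ y Y).map_add, add_apply]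
    abel
  · intro c X Y Z
    simp only [localCurvature, (fderiv ℝ Γ y).map_smul c X, (fderiv ℝ Γ y Y).map_smul c X,
      (Γ y).map_smul c X, (Γ y Y).map_smul, smul_apply]
    module
  · intro X Y Z
    simp only [localCurvature]
    abel

end IsLocalSasakian

end LocalCalculus

/-! ### Components of vectors, vector fields and Lie brackets in a preferred chart. -/

lemma mlieBracket_eq_lieBracket {F : Type*} [NormedAddCommGroup F] [NormedSpace ℝ F]
    (V W : ∀ x : F, TangentSpace 𝓘(ℝ, F) x) :
    VectorField.mlieBracket 𝓘(ℝ, F) V W = VectorField.lieBracket ℝ V W := by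
  rw [← VectorField.mlieBracketWithin_univ, VectorField.mlieBracketWithin_eq_lieBracketWithin]
  exact VectorField.lieBracketWithin_univ

section ChartCoordinates

open Filter Topology

variable {m : ℕ} {M : Type*} [TopologicalSpace M] [ChartedSpace (EuclideanSpace ℝ (Fin m)) M]

/-- The inverse of the preferred chart at `p`. -/
def chartPoint (p : M) (y : EuclideanSpace ℝ (Fin m)) : M := (extChartAt (𝓡 m) p).symm y

/-- The open subset of the model space covered by the preferred chart at `p`. -/
def chartDomain (m : ℕ) {M : Type*} [TopologicalSpace M]
    [ChartedSpace (EuclideanSpace ℝ (Fin m)) M] (p : M) : Set (EuclideanSpace ℝ (Fin m)) :=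
  (extChartAt (𝓡 m) p).target

lemma isOpen_chartDomain (p : M) : IsOpen (chartDomain m p) := isOpen_extChartAt_target p

lemma chartPoint_mem {p : M} {y : EuclideanSpace ℝ (Fin m)} (hy : y ∈ chartDomain m p) :
    chartPoint p y ∈ (chartAt (EuclideanSpace ℝ (Fin m)) p).source := by
  rw [← extChartAt_source (𝓡 m)]
  exact (extChartAt (𝓡 m) p).map_target hy

lemma mem_chartDomain (p : M) : extChartAt (𝓡 m) p p ∈ chartDomain m p :=
  mem_extChartAt_target p

lemma chartPoint_self (p : M) : chartPoint p (extChartAt (𝓡 m) p p) = p :=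
  extChartAt_to_inv p

variable [IsManifold (𝓡 m) ∞ M]

/-- The tangent vector at `q` with given components in the preferred chart at `p`. -/
def ofComponents (p q : M) : EuclideanSpace ℝ (Fin m) →L[ℝ] TangentSpace (𝓡 m) q :=
  (trivializationAt (EuclideanSpace ℝ (Fin m)) (fun x : M => TangentSpace (𝓡 m) x) p).symmL ℝ q

/-- The components, in the preferred chart at `p`, of tangent vectors at `q`. -/
def components (p q : M) : TangentSpace (𝓡 m) q →L[ℝ] EuclideanSpace ℝ (Fin m) :=
  (trivializationAt (EuclideanSpace ℝ (Fin m)) (fun x : M => TangentSpace (𝓡 m) x)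
    p).continuousLinearMapAt ℝ q

lemma components_ofComponents {p q : M}
    (hq : q ∈ (chartAt (EuclideanSpace ℝ (Fin m)) p).source) (u : EuclideanSpace ℝ (Fin m)) :
    components p q (ofComponents p q u) = u :=
  Trivialization.continuousLinearMapAt_symmL _ hq u

lemma ofComponents_components {p q : M}
    (hq : q ∈ (chartAt (EuclideanSpace ℝ (Fin m)) p).source) (v : TangentSpace (𝓡 m) q) :
    ofComponents p q (components p q v) = v :=
  Trivialization.symmL_continuousLinearMapAt _ hq v

lemma components_eq_trivializationAt {p q : M}
    (hq : q ∈ (chartAt (EuclideanSpace ℝ (Fin m)) p).source) (v : TangentSpace (𝓡 m) q) :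
    components p q v = (trivializationAt (EuclideanSpace ℝ (Fin m))
      (fun x : M => TangentSpace (𝓡 m) x) p ⟨q, v⟩).2 := by
  simp only [components]
  exact Trivialization.continuousLinearMapAt_apply_of_mem (R := ℝ)
    (trivializationAt (EuclideanSpace ℝ (Fin m)) (fun x : M => TangentSpace (𝓡 m) x) p) hq v

/-- A tangent vector at `p` is, by definition, its component vector in the preferred chart at `p`.
This reconciles the coordinate definitions of connection and curvature with the explicit
`components` map. -/
lemma components_self (p : M) (v : TangentSpace (𝓡 m) p) : components p p v = v := by
  rw [components, TangentBundle.continuousLinearMapAt_trivializationAt_eq_core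
    (mem_chart_source _ p)]
  exact (tangentBundleCore (𝓡 m) M).coordChange_self (achart _ p) p (mem_chart_source _ p) v

lemma contMDiffAt_chartPoint {p : M} {y : EuclideanSpace ℝ (Fin m)} (hy : y ∈ chartDomain m p) :
    ContMDiffAt 𝓘(ℝ, EuclideanSpace ℝ (Fin m)) (𝓡 m) ∞ (chartPoint p) y :=
  (contMDiffOn_extChartAt_symm p).contMDiffAt ((isOpen_chartDomain (m := m) p).mem_nhds hy)

lemma mfderiv_chartPoint {p : M} {y : EuclideanSpace ℝ (Fin m)} (hy : y ∈ chartDomain m p) :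
    mfderiv 𝓘(ℝ, EuclideanSpace ℝ (Fin m)) (𝓡 m) (chartPoint p) y
      = ofComponents p (chartPoint p y) := by
  rw [ofComponents, TangentBundle.symmL_trivializationAt (chartPoint_mem hy)]
  have h1 : extChartAt (𝓡 m) p (chartPoint p y) = y := (extChartAt (𝓡 m) p).right_inv hy
  have h2 : range (𝓡 m) = univ := by simp
  rw [h1, h2, mfderivWithin_univ]
  rfl

/-- The vector field with constant components in the preferred chart at `p`. -/
def constField (p : M) (u : EuclideanSpace ℝ (Fin m)) (q : M) : TangentSpace (𝓡 m) q :=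
  ofComponents p q u

lemma smoothVectorFieldAt_iff {p q : M}
    (hq : q ∈ (chartAt (EuclideanSpace ℝ (Fin m)) p).source)
    {V : ∀ x : M, TangentSpace (𝓡 m) x} :
    SmoothVectorFieldAt V q ↔
      ContMDiffAt (𝓡 m) 𝓘(ℝ, EuclideanSpace ℝ (Fin m)) ∞ (fun x => components p x (V x)) q := by
  rw [SmoothVectorFieldAt]
  have h := (trivializationAt (EuclideanSpace ℝ (Fin m)) (fun x : M => TangentSpace (𝓡 m) x)
    p).contMDiffAt_section_iff (IB := 𝓡 m) (n := ∞) (s := V) (x₀ := q) hq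
  refine h.trans (Filter.EventuallyEq.contMDiffAt_iff ?_)
  filter_upwards [(chartAt (EuclideanSpace ℝ (Fin m)) p).open_source.mem_nhds hq] with x hx
  exact (components_eq_trivializationAt hx _).symm

lemma smoothVectorFieldAt_constField {p q : M}
    (hq : q ∈ (chartAt (EuclideanSpace ℝ (Fin m)) p).source) (u : EuclideanSpace ℝ (Fin m)) :
    SmoothVectorFieldAt (constField p u) q := by
  rw [smoothVectorFieldAt_iff hq]
  refine (contMDiffAt_const (c := u)).congr_of_eventuallyEq ?_
  filter_upwards [(chartAt (EuclideanSpace ℝ (Fin m)) p).open_source.mem_nhds hq] with x hx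
  exact components_ofComponents hx u

lemma ContMDiffAt.contDiffAt_comp_chartPoint {F : Type*} [NormedAddCommGroup F] [NormedSpace ℝ F]
    {f : M → F} {p : M} {y : EuclideanSpace ℝ (Fin m)} (hy : y ∈ chartDomain m p)
    (hf : ContMDiffAt (𝓡 m) 𝓘(ℝ, F) ∞ f (chartPoint p y)) :
    ContDiffAt ℝ ∞ (fun z => f (chartPoint p z)) y :=
  (hf.comp y (contMDiffAt_chartPoint hy)).contDiffAt

lemma mvfderiv_constField {f : M → ℝ} {p : M} {y : EuclideanSpace ℝ (Fin m)}
    (hy : y ∈ chartDomain m p) (hf : ContMDiffAt (𝓡 m) 𝓘(ℝ, ℝ) ∞ f (chartPoint p y))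
    (u : EuclideanSpace ℝ (Fin m)) :
    mvfderiv (𝓡 m) f (chartPoint p y) (constField p u (chartPoint p y))
      = fderiv ℝ (fun z => f (chartPoint p z)) y u := by
  have h := mfderiv_comp (I := 𝓘(ℝ, EuclideanSpace ℝ (Fin m))) (I' := 𝓡 m) (I'' := 𝓘(ℝ, ℝ))
    (f := chartPoint p) (g := f) y (hf.mdifferentiableAt (by simp))
    ((contMDiffAt_chartPoint hy).mdifferentiableAt (by simp))
  rw [mfderiv_eq_fderiv, mfderiv_chartPoint hy] at h
  have h' := congrArg (fun L : EuclideanSpace ℝ (Fin m) →L[ℝ] ℝ => L u) h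
  exact h'.symm

lemma mpullback_chartPoint {p : M} {y : EuclideanSpace ℝ (Fin m)} (hy : y ∈ chartDomain m p)
    (V : ∀ x : M, TangentSpace (𝓡 m) x) :
    VectorField.mpullback 𝓘(ℝ, EuclideanSpace ℝ (Fin m)) (𝓡 m) (chartPoint p) V y
      = components p (chartPoint p y) (V (chartPoint p y)) := by
  rw [VectorField.mpullback_apply, mfderiv_chartPoint hy]
  have hq := chartPoint_mem hy
  have : (ofComponents (m := m) p (chartPoint p y)).inverse = components p (chartPoint p y) := by
    refine ContinuousLinearMap.inverse_eq ?_ ?_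
    · ext v
      exact ofComponents_components hq v
    · refine ContinuousLinearMap.ext fun v => ?_
      exact components_ofComponents hq v
  exact congrArg (fun L => L (V (chartPoint p y))) this

/-- Taking components is pullback along the inverse chart (`mpullback_chartPoint`), and the Lie
bracket is natural under pullback. -/
lemma components_mlieBracket {p : M} {y : EuclideanSpace ℝ (Fin m)} (hy : y ∈ chartDomain m p)
    {V W : ∀ x : M, TangentSpace (𝓡 m) x} (hV : SmoothVectorFieldAt V (chartPoint p y))
    (hW : SmoothVectorFieldAt W (chartPoint p y)) :
    components p (chartPoint p y) (VectorField.mlieBracket (𝓡 m) V W (chartPoint p y))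
      = VectorField.lieBracket ℝ (fun z => components p (chartPoint p z) (V (chartPoint p z)))
        (fun z => components p (chartPoint p z) (W (chartPoint p z))) y := by
  have : IsManifold (𝓡 m) (minSmoothness ℝ 2) M :=
    IsManifold.of_le (n := ∞) (by simp; norm_cast)
  rw [← mpullback_chartPoint hy, VectorField.mpullback_mlieBracket (n := ∞)
    (hV.mdifferentiableAt (by simp)) (hW.mdifferentiableAt (by simp)) (contMDiffAt_chartPoint hy)
    (by simp; norm_cast)]
  have hev : ∀ V : ∀ x : M, TangentSpace (𝓡 m) x,
      VectorField.mpullback 𝓘(ℝ, EuclideanSpace ℝ (Fin m)) (𝓡 m) (chartPoint p) V =ᶠ[𝓝 y]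
        fun z => components p (chartPoint p z) (V (chartPoint p z)) := by
    intro V
    filter_upwards [(isOpen_chartDomain (m := m) p).mem_nhds hy] with z hz using mpullback_chartPoint hz V
  rw [(hev V).mlieBracket_vectorField_eq (hev W)]
  exact congrFun (mlieBracket_eq_lieBracket _ _) y

end ChartCoordinates

/-! ### The Levi-Civita connection of a metric in coordinates, by the Koszul formula. -/

section LeviCivita

open Filter Topology

variable {E : Type*} [NormedAddCommGroup E] [NormedSpace ℝ E]

/-- Christoffel symbols of the first kind of the metric `G`. -/
def koszulForm (G : E → E →L[ℝ] E →L[ℝ] ℝ) (y u v : E) : E →L[ℝ] ℝ :=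
  (2⁻¹ : ℝ) • (fderiv ℝ G y u v + fderiv ℝ G y v u - ((fderiv ℝ G y).flip u).flip v)

lemma koszulForm_apply (G : E → E →L[ℝ] E →L[ℝ] ℝ) (y u v w : E) : koszulForm G y u v w =
    (fderiv ℝ G y u v w + fderiv ℝ G y v u w - fderiv ℝ G y w u v) / 2 := by
  simp only [koszulForm, smul_apply, sub_apply, add_apply, ContinuousLinearMap.flip_apply,
    smul_eq_mul]
  ring

variable [FiniteDimensional ℝ E]

/-- Christoffel symbols of the second kind of the metric `G`, as a bilinear map. -/
def leviCivita (G : E → E →L[ℝ] E →L[ℝ] ℝ) (y : E) : E →L[ℝ] E →L[ℝ] E :=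
  LinearMap.toContinuousBilinearMap <| LinearMap.mk₂ ℝ
    (fun u v => (G y).inverse (koszulForm G y u v))
    (fun u u' v => by
      rw [← map_add]; congr 1; ext w
      simp only [add_apply, koszulForm_apply, (fderiv ℝ G y).map_add u u',
        (fderiv ℝ G y v).map_add u u', (fderiv ℝ G y w).map_add u u']
      ring)
    (fun c u v => by
      rw [← map_smul]; congr 1; ext w
      simp only [smul_apply, koszulForm_apply, (fderiv ℝ G y).map_smul c u,
        (fderiv ℝ G y v).map_smul c u, (fderiv ℝ G y w).map_smul c u, smul_eq_mul]
      ring)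
    (fun u v v' => by
      rw [← map_add]; congr 1; ext w
      simp only [add_apply, koszulForm_apply, (fderiv ℝ G y).map_add v v',
        (fderiv ℝ G y u).map_add v v', (fderiv ℝ G y w u).map_add v v']
      ring)
    (fun c u v => by
      rw [← map_smul]; congr 1; ext w
      simp only [smul_apply, koszulForm_apply, (fderiv ℝ G y).map_smul c v,
        (fderiv ℝ G y u).map_smul c v, (fderiv ℝ G y w u).map_smul c v, smul_eq_mul]
      ring)

lemma leviCivita_apply (G : E → E →L[ℝ] E →L[ℝ] ℝ) (y u v : E) :
    leviCivita G y u v = (G y).inverse (koszulForm G y u v) := rfl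

lemma isInvertible_of_nondeg (B : E →L[ℝ] E →L[ℝ] ℝ)
    (h : ∀ u v, (∀ w, B u w = B v w) → u = v) : B.IsInvertible := by
  have hinj : Function.Injective B.toLinearMap := fun u v huv =>
    h u v fun w => congrArg (fun L : E →L[ℝ] ℝ => L w) huv
  have hdim : Module.finrank ℝ E = Module.finrank ℝ (E →L[ℝ] ℝ) := by
    rw [← (LinearMap.toContinuousLinearMap (𝕜 := ℝ) (E := E) (F' := ℝ)).finrank_eq]
    exact (Subspace.dual_finrank_eq (K := ℝ) (V := E)).symm
  refine ⟨(LinearMap.linearEquivOfInjective B.toLinearMap hinj hdim).toContinuousLinearEquiv, ?_⟩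
  ext u v
  rfl

variable {U : Set E} {G : E → E →L[ℝ] E →L[ℝ] ℝ}

lemma metric_leviCivita (hnd : ∀ y ∈ U, ∀ u v, (∀ w, G y u w = G y v w) → u = v)
    {y : E} (hy : y ∈ U) (u v : E) : G y (leviCivita G y u v) = koszulForm G y u v := by
  rw [leviCivita_apply, (isInvertible_of_nondeg _ (hnd y hy)).self_apply_inverse]

/-- Torsion freeness and parallelism are checked after lowering an index, where they are symmetries
of `koszulForm`. Smoothness follows from that of inversion at the invertible operators `G y`. -/
lemma isLocalLeviCivita_leviCivita (hU : IsOpen U) (hG : ContDiffOn ℝ ∞ G U)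
    (hsymm : ∀ y ∈ U, ∀ u v, G y u v = G y v u)
    (hnd : ∀ y ∈ U, ∀ u v, (∀ w, G y u w = G y v w) → u = v) :
    IsLocalLeviCivita U G (leviCivita G) := by
  have hsymm' : ∀ y ∈ U, ∀ w u v, fderiv ℝ G y w u v = fderiv ℝ G y w v u := by
    intro y hy w u v
    have hdiff := hG.differentiableAt_of_isOpen hU hy
    refine (hdiff.hasDerivAt_line_apply_const_const w u v).unique
      ((hdiff.hasDerivAt_line_apply_const_const w v u).congr_of_eventuallyEq ?_)
    filter_upwards [(tendsto_line y w).eventually (hU.mem_nhds hy)] with t ht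
      using hsymm _ ht _ _
  have hd3 : ∀ u v w, ContDiffOn ℝ ∞ (fun y => fderiv ℝ G y u v w) U := by
    intro u v w
    have hvw : ContDiffOn ℝ ∞ (fun y => G y v w) U :=
      (hG.clm_apply contDiffOn_const).clm_apply contDiffOn_const
    have hd : ContDiffOn ℝ ∞ (fderiv ℝ fun y => G y v w) U :=
      hvw.fderiv_of_isOpen hU (by norm_cast)
    refine (hd.clm_apply (contDiffOn_const (c := u))).congr fun y hy => ?_
    exact ((hG.differentiableAt_of_isOpen hU hy).hasDerivAt_line_apply_const_const u v w).unique
      ((hvw.differentiableAt_of_isOpen hU hy).hasDerivAt_line u)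
  have hK : ∀ u v, ContDiffOn ℝ ∞ (fun y => koszulForm G y u v) U := by
    intro u v
    rw [contDiffOn_clm_apply]
    intro w
    simp only [koszulForm_apply]
    exact (((hd3 u v w).add (hd3 v u w)).sub (hd3 w u v)).div_const 2
  refine ⟨hU, hG, ?_, hsymm, hnd, ?_, ?_⟩
  · rw [contDiffOn_clm_apply]
    intro u
    rw [contDiffOn_clm_apply]
    intro v
    simp only [leviCivita_apply]
    refine ContDiffOn.clm_apply ?_ (hK u v)
    intro y hy
    exact ((isInvertible_of_nondeg _ (hnd y hy)).contDiffAt_map_inverse).comp_contDiffWithinAt y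
      (hG y hy)
  · intro y hy u v
    refine hnd y hy _ _ fun w => ?_
    rw [metric_leviCivita hnd hy, metric_leviCivita hnd hy, koszulForm_apply, koszulForm_apply,
      hsymm' y hy w u v]
    ring
  · intro y hy w u v
    rw [hsymm y hy u, metric_leviCivita hnd hy, metric_leviCivita hnd hy, koszulForm_apply,
      koszulForm_apply, hsymm' y hy w v u, hsymm' y hy u w v, hsymm' y hy v w u]
    ring

end LeviCivita

/-! ### The metric, Christoffel symbols and curvature operator in a chart. -/

section ChartMetric

open Filter Topology

variable {m : ℕ} {M : Type*} [TopologicalSpace M] [ChartedSpace (EuclideanSpace ℝ (Fin m)) M]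
  [IsManifold (𝓡 m) ∞ M]

/-- The metric in the preferred chart at `p`, as a bilinear form. -/
def chartMetric (g : SmoothMetric m M) (p : M) (y : EuclideanSpace ℝ (Fin m)) :
    EuclideanSpace ℝ (Fin m) →L[ℝ] EuclideanSpace ℝ (Fin m) →L[ℝ] ℝ :=
  ((ofComponents p (chartPoint p y)).precomp ℝ).comp
    ((g.inner (chartPoint p y)).comp (ofComponents p (chartPoint p y)))

lemma chartMetric_apply (g : SmoothMetric m M) (p : M) (y u v : EuclideanSpace ℝ (Fin m)) :
    chartMetric g p y u v = g.inner (chartPoint p y) (constField p u (chartPoint p y))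
      (constField p v (chartPoint p y)) := rfl

lemma metricInChart_eq (g : SmoothMetric m M) {p : M} {y : EuclideanSpace ℝ (Fin m)}
    (hy : y ∈ chartDomain m p) (u v : EuclideanSpace ℝ (Fin m)) :
    metricInChart g p y u v = chartMetric g p y u v := by
  have hq := chartPoint_mem hy
  rw [chartMetric_apply, constField, constField, ofComponents,
    Trivialization.symmL_apply _ hq, Trivialization.symmL_apply _ hq]
  rfl

lemma chartMetric_components (g : SmoothMetric m M) (p : M) (u v : TangentSpace (𝓡 m) p) :
    chartMetric g p (extChartAt (𝓡 m) p p) (components p p u) (components p p v)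
      = g.inner p u v := by
  rw [chartMetric_apply]
  have h := chartPoint_self (m := m) p
  have hq := mem_chart_source (EuclideanSpace ℝ (Fin m)) p
  -- The equality `chartPoint p (extChartAt p p) = p` is not definitional and the tangent spaces
  -- depend on the point, so the point is generalized before substitution.
  have key : ∀ q, q = p → g.inner q (constField p (components p p u) q)
      (constField p (components p p v) q) = g.inner p u v := by
    rintro q rfl
    rw [constField, constField, ofComponents_components hq, ofComponents_components hq]
  exact key _ h

lemma contMDiffAt_inner (g : SmoothMetric m M) {q : M} {X Y : ∀ x : M, TangentSpace (𝓡 m) x}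
    (hX : SmoothVectorFieldAt X q) (hY : SmoothVectorFieldAt Y q) :
    ContMDiffAt (𝓡 m) 𝓘(ℝ, ℝ) ∞ (fun x => g.inner x (X x) (Y x)) q := by
  have h : ContMDiffAt (𝓡 m) ((𝓡 m).prod 𝓘(ℝ, ℝ)) ∞
      (fun x => TotalSpace.mk' ℝ (E := Bundle.Trivial M ℝ) x (g.inner x (X x) (Y x))) q := by
    apply ContMDiffAt.clm_bundle_apply₂ (F₁ := EuclideanSpace ℝ (Fin m))
      (F₂ := EuclideanSpace ℝ (Fin m))
    · exact g.contMDiff.contMDiffAt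
    · exact hX
    · exact hY
  rw [contMDiffAt_totalSpace] at h
  exact h.2

lemma chartMetric_symm (g : SmoothMetric m M) (p : M) (y u v : EuclideanSpace ℝ (Fin m)) :
    chartMetric g p y u v = chartMetric g p y v u := g.symm _ _ _

lemma chartMetric_pos (g : SmoothMetric m M) {p : M} {y : EuclideanSpace ℝ (Fin m)}
    (hy : y ∈ chartDomain m p) (u : EuclideanSpace ℝ (Fin m)) (hu : u ≠ 0) :
    0 < chartMetric g p y u u := by
  refine g.pos _ _ fun h => hu ?_
  rw [← components_ofComponents (chartPoint_mem hy) u]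
  exact (congrArg _ h).trans (map_zero _)

lemma chartMetric_nondeg (g : SmoothMetric m M) {p : M} {y : EuclideanSpace ℝ (Fin m)}
    (hy : y ∈ chartDomain m p) (u v : EuclideanSpace ℝ (Fin m))
    (h : ∀ w, chartMetric g p y u w = chartMetric g p y v w) : u = v := by
  by_contra hne
  have := chartMetric_pos g hy (u - v) (sub_ne_zero.2 hne)
  simp [h] at this

lemma contDiffOn_chartMetric (g : SmoothMetric m M) (p : M) :
    ContDiffOn ℝ ∞ (chartMetric g p) (chartDomain m p) := by
  rw [contDiffOn_clm_apply]
  intro u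
  rw [contDiffOn_clm_apply]
  intro v y hy
  exact (ContMDiffAt.contDiffAt_comp_chartPoint hy (contMDiffAt_inner g
    (smoothVectorFieldAt_constField (chartPoint_mem hy) u)
    (smoothVectorFieldAt_constField (chartPoint_mem hy) v))).contDiffWithinAt

/-- The Levi-Civita connection in the preferred chart at `p`. -/
def chartConnection (g : SmoothMetric m M) (p : M) : EuclideanSpace ℝ (Fin m) →
    EuclideanSpace ℝ (Fin m) →L[ℝ] EuclideanSpace ℝ (Fin m) →L[ℝ] EuclideanSpace ℝ (Fin m) :=
  leviCivita (chartMetric g p)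

lemma isLocalLeviCivita_chartConnection (g : SmoothMetric m M) (p : M) :
    IsLocalLeviCivita (chartDomain m p) (chartMetric g p) (chartConnection g p) :=
  isLocalLeviCivita_leviCivita (isOpen_chartDomain p) (contDiffOn_chartMetric g p)
    (fun y _ => chartMetric_symm g p y) (fun _ hy => chartMetric_nondeg g hy)

lemma christoffelFirst_eq (g : SmoothMetric m M) {p : M} {y : EuclideanSpace ℝ (Fin m)}
    (hy : y ∈ chartDomain m p) (u v w : EuclideanSpace ℝ (Fin m)) :
    christoffelFirst g p y u v w = koszulForm (chartMetric g p) y u v w := by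
  have hd := (contDiffOn_chartMetric g p).differentiableAt_of_isOpen (isOpen_chartDomain p) hy
  have key : ∀ u v w, fderiv ℝ (fun z => metricInChart g p z v w) y u
      = fderiv ℝ (chartMetric g p) y u v w := by
    intro u v w
    have hd' : DifferentiableAt ℝ (fun z => chartMetric g p z v w) y :=
      (hd.clm_apply (differentiableAt_const v)).clm_apply (differentiableAt_const w)
    have hev : (fun z => metricInChart g p z v w) =ᶠ[𝓝 y] fun z => chartMetric g p z v w := by
      filter_upwards [(isOpen_chartDomain (m := m) p).mem_nhds hy] with z hz
        using metricInChart_eq g hz v w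
    rw [hev.fderiv_eq]
    exact (hd'.hasDerivAt_line u).unique (hd.hasDerivAt_line_apply_const_const u v w)
  rw [christoffelFirst, key, key, key, koszulForm_apply]

lemma clm_apply_eq_sum {F : Type*} [NormedAddCommGroup F] [NormedSpace ℝ F]
    (L : EuclideanSpace ℝ (Fin m) →L[ℝ] F) (w : EuclideanSpace ℝ (Fin m)) :
    L w = ∑ j, w j • L (EuclideanSpace.single j 1) := by
  have h := (EuclideanSpace.basisFun (Fin m) ℝ).sum_repr w
  simp only [EuclideanSpace.basisFun_repr, EuclideanSpace.basisFun_apply] at h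
  conv_lhs => rw [← h]
  simp only [map_sum, map_smul]

lemma gramMatrix_apply (g : SmoothMetric m M) {p : M} {y : EuclideanSpace ℝ (Fin m)}
    (hy : y ∈ chartDomain m p) (i j : Fin m) : gramMatrix g p y i j =
      chartMetric g p y (EuclideanSpace.single i 1) (EuclideanSpace.single j 1) := by
  rw [gramMatrix, Matrix.of_apply, metricInChart_eq g hy]

lemma gramMatrix_inv_mul (g : SmoothMetric m M) {p : M} {y : EuclideanSpace ℝ (Fin m)}
    (hy : y ∈ chartDomain m p) : (gramMatrix g p y)⁻¹ * gramMatrix g p y = 1 := by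
  refine Matrix.nonsing_inv_mul _ (isUnit_iff_ne_zero.2 fun h0 => ?_)
  obtain ⟨v, hv, hMv⟩ := Matrix.exists_mulVec_eq_zero_iff.2 h0
  have hw : WithLp.toLp 2 v ≠ 0 := fun h => hv (by simpa using congrArg WithLp.ofLp h)
  refine (chartMetric_pos g hy _ hw).ne' ?_
  rw [chartMetric_symm, clm_apply_eq_sum]
  refine Finset.sum_eq_zero fun i _ => ?_
  rw [chartMetric_symm, clm_apply_eq_sum]
  have := congrFun hMv i
  simp only [Matrix.mulVec, dotProduct, gramMatrix_apply g hy, Pi.zero_apply] at this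
  simp only [smul_eq_mul]
  rw [← mul_zero (v i), ← this]
  simp only [mul_comm]

/-- Raising an index with the inverse Gram matrix agrees with inverting `G y`: lowered again with
the metric, both sides become the Koszul form on the coordinate basis. -/
lemma christoffel_eq (g : SmoothMetric m M) {p : M} {y : EuclideanSpace ℝ (Fin m)}
    (hy : y ∈ chartDomain m p) (u v : EuclideanSpace ℝ (Fin m)) :
    christoffel g p y u v = chartConnection g p y u v := by
  refine chartMetric_nondeg g hy _ _ fun w => ?_
  rw [chartConnection, metric_leviCivita (fun _ hy => chartMetric_nondeg g hy) hy,
    clm_apply_eq_sum, clm_apply_eq_sum (koszulForm _ _ _ _)]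
  refine Finset.sum_congr rfl fun k _ => ?_
  rw [chartMetric_symm, clm_apply_eq_sum]
  congr 1
  simp only [christoffel, smul_eq_mul, christoffelFirst_eq g hy, Finset.sum_mul]
  rw [Finset.sum_comm]
  have h := gramMatrix_inv_mul g hy
  have hsymm : ∀ i j, (gramMatrix g p y)⁻¹ i j = (gramMatrix g p y)⁻¹ j i := by
    intro i j
    have ht : (gramMatrix g p y).transpose = gramMatrix g p y := by
      ext i j
      rw [Matrix.transpose_apply, gramMatrix_apply g hy, gramMatrix_apply g hy, chartMetric_symm]
    conv_lhs => rw [← ht, ← Matrix.transpose_nonsing_inv, Matrix.transpose_apply]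
  have key : ∀ l, ∑ i, (gramMatrix g p y)⁻¹ i l * koszulForm (chartMetric g p) y u v
        (EuclideanSpace.single l 1) *
        chartMetric g p y (EuclideanSpace.single k 1) (EuclideanSpace.single i 1)
      = (1 : Matrix (Fin m) (Fin m) ℝ) l k * koszulForm (chartMetric g p) y u v
        (EuclideanSpace.single l 1) := by
    intro l
    rw [← h, Matrix.mul_apply, Finset.sum_mul]
    refine Finset.sum_congr rfl fun i _ => ?_
    rw [gramMatrix_apply g hy, hsymm i l, chartMetric_symm]
    ring
  simp only [key, Matrix.one_apply, ite_mul, one_mul, zero_mul, Finset.sum_ite_eq',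
    Finset.mem_univ, if_true]

lemma components_curvatureOp (g : SmoothMetric m M) (p : M) (X Y Z : TangentSpace (𝓡 m) p) :
    components p p (curvatureOp g p X Y Z)
      = localCurvature (chartConnection g p) (extChartAt (𝓡 m) p p) (components p p X)
        (components p p Y) (components p p Z) := by
  have hy := mem_chartDomain (m := m) p
  have hd := (isLocalLeviCivita_chartConnection g p).smooth_connection.differentiableAt_of_isOpen
    (isOpen_chartDomain p) hy
  have key : ∀ u v w : EuclideanSpace ℝ (Fin m),
      fderiv ℝ (fun z => christoffel g p z v w) (extChartAt (𝓡 m) p p) u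
      = fderiv ℝ (chartConnection g p) (extChartAt (𝓡 m) p p) u v w := by
    intro u v w
    have hev : (fun z => christoffel g p z v w) =ᶠ[𝓝 (extChartAt (𝓡 m) p p)]
        fun z => chartConnection g p z v w := by
      filter_upwards [(isOpen_chartDomain (m := m) p).mem_nhds hy] with z hz
        using christoffel_eq g hz v w
    have hd' : DifferentiableAt ℝ (fun z => chartConnection g p z v w) (extChartAt (𝓡 m) p p) :=
      (hd.clm_apply (differentiableAt_const v)).clm_apply (differentiableAt_const w)
    rw [hev.fderiv_eq]
    exact (hd'.hasDerivAt_line u).unique (hd.hasDerivAt_line_apply_const_const u v w)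
  have main : ∀ u v w : EuclideanSpace ℝ (Fin m),
      fderiv ℝ (fun z => christoffel g p z v w) (extChartAt (𝓡 m) p p) u
        - fderiv ℝ (fun z => christoffel g p z u w) (extChartAt (𝓡 m) p p) v
        + christoffel g p (extChartAt (𝓡 m) p p) u (christoffel g p (extChartAt (𝓡 m) p p) v w)
        - christoffel g p (extChartAt (𝓡 m) p p) v (christoffel g p (extChartAt (𝓡 m) p p) u w)
      = localCurvature (chartConnection g p) (extChartAt (𝓡 m) p p) u v w := by
    intro u v w
    rw [key, key, christoffel_eq g hy, christoffel_eq g hy, christoffel_eq g hy,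
      christoffel_eq g hy, localCurvature]
  have e : ∀ u v w : EuclideanSpace ℝ (Fin m), u = X → v = Y → w = Z →
      curvatureOp g p X Y Z
        = localCurvature (chartConnection g p) (extChartAt (𝓡 m) p p) u v w := by
    rintro _ _ _ rfl rfl rfl
    exact main _ _ _
  exact (components_self p _).trans
    (e _ _ _ (components_self p X) (components_self p Y) (components_self p Z))

end ChartMetric

/-! ### Endomorphism fields, forms and vector fields in a chart. -/

section ChartTensors

open Filter Topology

variable {m : ℕ} {M : Type*} [TopologicalSpace M] [ChartedSpace (EuclideanSpace ℝ (Fin m)) M]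
  [IsManifold (𝓡 m) ∞ M]

/-- A field of endomorphisms in the preferred chart at `p`. -/
def chartEndomorphism (φ : ∀ x : M, TangentSpace (𝓡 m) x →L[ℝ] TangentSpace (𝓡 m) x) (p : M)
    (y : EuclideanSpace ℝ (Fin m)) : EuclideanSpace ℝ (Fin m) →L[ℝ] EuclideanSpace ℝ (Fin m) :=
  (components p (chartPoint p y)).comp ((φ (chartPoint p y)).comp (ofComponents p (chartPoint p y)))

/-- A `1`-form in the preferred chart at `p`. -/
def chartForm (η : ∀ x : M, TangentSpace (𝓡 m) x →L[ℝ] ℝ) (p : M)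
    (y : EuclideanSpace ℝ (Fin m)) : EuclideanSpace ℝ (Fin m) →L[ℝ] ℝ :=
  (η (chartPoint p y)).comp (ofComponents p (chartPoint p y))

/-- A vector field in the preferred chart at `p`. -/
def chartField (V : ∀ x : M, TangentSpace (𝓡 m) x) (p : M) (y : EuclideanSpace ℝ (Fin m)) :
    EuclideanSpace ℝ (Fin m) :=
  components p (chartPoint p y) (V (chartPoint p y))

lemma contDiffOn_chartField {V : ∀ x : M, TangentSpace (𝓡 m) x}
    (hV : ∀ q, SmoothVectorFieldAt V q) (p : M) :
    ContDiffOn ℝ ∞ (chartField V p) (chartDomain m p) := fun _ hy =>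
  (ContMDiffAt.contDiffAt_comp_chartPoint hy
    ((smoothVectorFieldAt_iff (chartPoint_mem hy)).1 (hV _))).contDiffWithinAt

lemma chartField_constField (p : M) (u : EuclideanSpace ℝ (Fin m))
    {y : EuclideanSpace ℝ (Fin m)} (hy : y ∈ chartDomain m p) :
    chartField (constField p u) p y = u := components_ofComponents (chartPoint_mem hy) u

lemma fderiv_chartField_constField (p : M) (u : EuclideanSpace ℝ (Fin m))
    {y : EuclideanSpace ℝ (Fin m)} (hy : y ∈ chartDomain m p) :
    fderiv ℝ (chartField (constField p u) p) y = 0 := by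
  have hev : chartField (constField p u) p =ᶠ[𝓝 y] fun _ => u := by
    filter_upwards [(isOpen_chartDomain (m := m) p).mem_nhds hy] with z hz
      using chartField_constField p u hz
  rw [hev.fderiv_eq, fderiv_const_apply]

lemma mlieBracket_constField (p : M) (u v : EuclideanSpace ℝ (Fin m))
    {y : EuclideanSpace ℝ (Fin m)} (hy : y ∈ chartDomain m p) :
    VectorField.mlieBracket (𝓡 m) (constField p u) (constField p v) (chartPoint p y) = 0 := by
  have hq := chartPoint_mem hy
  have h := components_mlieBracket hy (smoothVectorFieldAt_constField hq u)
    (smoothVectorFieldAt_constField hq v)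
  have h0 : VectorField.lieBracket ℝ (chartField (constField p u) p)
      (chartField (constField p v) p) y = 0 := by
    rw [VectorField.lieBracket, fderiv_chartField_constField p u hy,
      fderiv_chartField_constField p v hy]
    simp
  rw [← ofComponents_components hq (VectorField.mlieBracket (𝓡 m) _ _ _)]
  exact (congrArg _ (h.trans h0)).trans (map_zero _)

lemma chartField_self (V : ∀ x : M, TangentSpace (𝓡 m) x) (p : M) :
    chartField V p (extChartAt (𝓡 m) p p) = components p p (V p) := by
  have key : ∀ q, q = p → components p q (V q) = components p p (V p) := by
    rintro q rfl
    rfl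
  exact key _ (chartPoint_self p)

lemma chartForm_components (η : ∀ x : M, TangentSpace (𝓡 m) x →L[ℝ] ℝ) {p q : M}
    (hq : q ∈ (chartAt (EuclideanSpace ℝ (Fin m)) p).source) (v : TangentSpace (𝓡 m) q) :
    chartForm η p (extChartAt (𝓡 m) p q) (components p q v) = η q v := by
  have key : ∀ q', q' = q → η q' (ofComponents p q' (components p q v)) = η q v := by
    rintro q rfl
    rw [ofComponents_components hq]
  exact key _ ((extChartAt (𝓡 m) p).left_inv (by rwa [extChartAt_source]))

lemma chartEndomorphism_components
    (φ : ∀ x : M, TangentSpace (𝓡 m) x →L[ℝ] TangentSpace (𝓡 m) x) (p : M)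
    (v : TangentSpace (𝓡 m) p) :
    chartEndomorphism φ p (extChartAt (𝓡 m) p p) (components p p v)
      = components p p (φ p v) := by
  have key : ∀ q, q = p → components p q (φ q (ofComponents p q (components p p v)))
      = components p p (φ p v) := by
    rintro q rfl
    rw [ofComponents_components (mem_chart_source _ q)]
  exact key _ (chartPoint_self p)

lemma components_injective (p : M) :
    Function.Injective (components p p : TangentSpace (𝓡 m) p → EuclideanSpace ℝ (Fin m)) :=
  Function.LeftInverse.injective fun v => ofComponents_components (mem_chart_source _ p) v

end ChartTensors

/-! ### The contact metric and Sasakian conditions in a chart, and the curvature for `c = 1`. -/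

namespace ContactMetricStructure

open Filter Topology

variable {n : ℕ} {N : Type*} [TopologicalSpace N]
  [ChartedSpace (EuclideanSpace ℝ (Fin (2 * n + 1))) N] [IsManifold (𝓡 (2 * n + 1)) ∞ N]
  (S : ContactMetricStructure n N)

lemma smoothVectorFieldAt_φ {q : N} {X : ∀ x : N, TangentSpace (𝓡 (2 * n + 1)) x}
    (hX : SmoothVectorFieldAt X q) : SmoothVectorFieldAt (fun x => S.φ x (X x)) q := by
  apply ContMDiffAt.clm_bundle_apply (F₁ := EuclideanSpace ℝ (Fin (2 * n + 1)))
    (F₂ := EuclideanSpace ℝ (Fin (2 * n + 1)))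
  · exact S.smooth_φ.contMDiffAt
  · exact hX

lemma contMDiffAt_η {q : N} {X : ∀ x : N, TangentSpace (𝓡 (2 * n + 1)) x}
    (hX : SmoothVectorFieldAt X q) :
    ContMDiffAt (𝓡 (2 * n + 1)) 𝓘(ℝ, ℝ) ∞ (fun x => S.η x (X x)) q := by
  have h : ContMDiffAt (𝓡 (2 * n + 1)) ((𝓡 (2 * n + 1)).prod 𝓘(ℝ, ℝ)) ∞
      (fun x => TotalSpace.mk' ℝ (E := Bundle.Trivial N ℝ) x (S.η x (X x))) q := by
    apply ContMDiffAt.clm_bundle_apply (F₁ := EuclideanSpace ℝ (Fin (2 * n + 1)))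
    · exact S.smooth_η.contMDiffAt
    · exact hX
  rw [contMDiffAt_totalSpace] at h
  exact h.2

variable (p : N)

lemma contDiffOn_chartEndomorphism :
    ContDiffOn ℝ ∞ (chartEndomorphism S.φ p) (chartDomain (2 * n + 1) p) := by
  rw [contDiffOn_clm_apply]
  intro u y hy
  have hq := chartPoint_mem hy
  exact (ContMDiffAt.contDiffAt_comp_chartPoint hy ((smoothVectorFieldAt_iff hq).1
    (S.smoothVectorFieldAt_φ (smoothVectorFieldAt_constField hq u)))).contDiffWithinAt

lemma contDiffOn_chartForm :
    ContDiffOn ℝ ∞ (chartForm S.η p) (chartDomain (2 * n + 1) p) := by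
  rw [contDiffOn_clm_apply]
  intro u y hy
  exact (ContMDiffAt.contDiffAt_comp_chartPoint hy (S.contMDiffAt_η
    (smoothVectorFieldAt_constField (chartPoint_mem hy) u))).contDiffWithinAt

variable {p} {y : EuclideanSpace ℝ (Fin (2 * n + 1))}

lemma isAlmostContactMetric (hy : y ∈ chartDomain (2 * n + 1) p) :
    IsAlmostContactMetric (chartMetric S.g p y) (chartEndomorphism S.φ p y) (chartField S.ξ p y)
      (chartForm S.η p y) where
  symm := chartMetric_symm S.g p y
  pos := chartMetric_pos S.g hy
  φ_φ X := by
    have hq := chartPoint_mem hy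
    simp only [chartEndomorphism, chartField, chartForm, ContinuousLinearMap.comp_apply,
      ofComponents_components hq, S.φ_φ, map_add, map_neg, map_smul,
      components_ofComponents hq]
  η_ξ := by
    simp only [chartField, chartForm, ContinuousLinearMap.comp_apply,
      ofComponents_components (chartPoint_mem hy), S.η_ξ]
  g_φ_φ X Y := by
    simp only [chartMetric_apply, constField, chartEndomorphism, chartForm,
      ContinuousLinearMap.comp_apply, ofComponents_components (chartPoint_mem hy), S.g_φ_φ]

lemma chartMetric_chartEndomorphism (hy : y ∈ chartDomain (2 * n + 1) p)
    (u v : EuclideanSpace ℝ (Fin (2 * n + 1))) :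
    chartMetric S.g p y u (chartEndomorphism S.φ p y v)
      = extDerivForm S.η (constField p u) (constField p v) (chartPoint p y) := by
  have hq := chartPoint_mem hy
  rw [← S.g_φ _ _ _ (smoothVectorFieldAt_constField hq u) (smoothVectorFieldAt_constField hq v)]
  simp only [chartMetric_apply, constField, chartEndomorphism,
    ContinuousLinearMap.comp_apply, ofComponents_components hq]

/-- The contact condition is tested on fields with constant components, whose bracket vanishes; the
factor 2 is the normalization of `dη`. -/
lemma fderiv_chartForm (hy : y ∈ chartDomain (2 * n + 1) p)
    (u v : EuclideanSpace ℝ (Fin (2 * n + 1))) :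
    2 * chartMetric S.g p y u (chartEndomorphism S.φ p y v)
      = fderiv ℝ (chartForm S.η p) y u v - fderiv ℝ (chartForm S.η p) y v u := by
  have hq := chartPoint_mem hy
  have hd := (S.contDiffOn_chartForm p).differentiableAt_of_isOpen (isOpen_chartDomain p) hy
  have key : ∀ u v, mvfderiv (𝓡 (2 * n + 1)) (fun x => S.η x (constField p v x)) (chartPoint p y)
      (constField p u (chartPoint p y)) = fderiv ℝ (chartForm S.η p) y u v := by
    intro u v
    rw [mvfderiv_constField hy (S.contMDiffAt_η (smoothVectorFieldAt_constField hq v))]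
    exact ((hd.clm_apply (differentiableAt_const v)).hasDerivAt_line u).unique
      (hd.hasDerivAt_line_apply_const u v)
  rw [chartMetric_chartEndomorphism S hy, extDerivForm, mlieBracket_constField p u v hy, key, key,
    map_zero]
  ring

end ContactMetricStructure

namespace SasakianStructure

open Filter Topology

variable {n : ℕ} {N : Type*} [TopologicalSpace N]
  [ChartedSpace (EuclideanSpace ℝ (Fin (2 * n + 1))) N] [IsManifold (𝓡 (2 * n + 1)) ∞ N]
  (S : SasakianStructure n N)

/-- Normality is tested on constant fields `u, v`. The `φ²[u, v]` term drops out, the other brackets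
are first derivatives of `φ`, and the contact condition replaces `dη(u, v)` by `g(u, φv)`. -/
lemma chart_normal {p : N} {y : EuclideanSpace ℝ (Fin (2 * n + 1))}
    (hy : y ∈ chartDomain (2 * n + 1) p) (u v : EuclideanSpace ℝ (Fin (2 * n + 1))) :
    fderiv ℝ (chartEndomorphism S.φ p) y (chartEndomorphism S.φ p y u) v
      - fderiv ℝ (chartEndomorphism S.φ p) y (chartEndomorphism S.φ p y v) u
      + chartEndomorphism S.φ p y (fderiv ℝ (chartEndomorphism S.φ p) y v u)
      - chartEndomorphism S.φ p y (fderiv ℝ (chartEndomorphism S.φ p) y u v)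
      + (2 * chartMetric S.g p y u (chartEndomorphism S.φ p y v)) • chartField S.ξ p y = 0 := by
  have hq := chartPoint_mem hy
  have hd := (S.contDiffOn_chartEndomorphism p).differentiableAt_of_isOpen
    (isOpen_chartDomain p) hy
  have hX := smoothVectorFieldAt_constField hq u
  have hY := smoothVectorFieldAt_constField hq v
  have hφX := S.smoothVectorFieldAt_φ hX
  have hφY := S.smoothVectorFieldAt_φ hY
  have hder : ∀ u w, fderiv ℝ (fun z => chartEndomorphism S.φ p z u) y w
      = fderiv ℝ (chartEndomorphism S.φ p) y w u := fun u w =>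
    ((hd.clm_apply (differentiableAt_const u)).hasDerivAt_line w).unique
      (hd.hasDerivAt_line_apply_const w u)
  have h1 : components p (chartPoint p y) (VectorField.mlieBracket (𝓡 (2 * n + 1))
      (fun x => S.φ x (constField p u x)) (fun x => S.φ x (constField p v x)) (chartPoint p y))
      = fderiv ℝ (chartEndomorphism S.φ p) y (chartEndomorphism S.φ p y u) v
      - fderiv ℝ (chartEndomorphism S.φ p) y (chartEndomorphism S.φ p y v) u := by
    rw [components_mlieBracket hy hφX hφY, ← hder, ← hder]
    rfl
  have h2 : components p (chartPoint p y) (VectorField.mlieBracket (𝓡 (2 * n + 1))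
      (fun x => S.φ x (constField p u x)) (constField p v) (chartPoint p y))
      = - fderiv ℝ (chartEndomorphism S.φ p) y v u := by
    have e : VectorField.lieBracket ℝ (fun z => chartEndomorphism S.φ p z u)
        (chartField (constField p v) p) y = - fderiv ℝ (chartEndomorphism S.φ p) y v u := by
      rw [VectorField.lieBracket, fderiv_chartField_constField p v hy,
        chartField_constField p v hy, hder]
      simp
    rw [components_mlieBracket hy hφX hY]
    exact e
  have h3 : components p (chartPoint p y) (VectorField.mlieBracket (𝓡 (2 * n + 1))
      (constField p u) (fun x => S.φ x (constField p v x)) (chartPoint p y))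
      = fderiv ℝ (chartEndomorphism S.φ p) y u v := by
    have e : VectorField.lieBracket ℝ (chartField (constField p u) p)
        (fun z => chartEndomorphism S.φ p z v) y = fderiv ℝ (chartEndomorphism S.φ p) y u v := by
      rw [VectorField.lieBracket, fderiv_chartField_constField p u hy,
        chartField_constField p u hy, hder]
      simp
    rw [components_mlieBracket hy hX hφY]
    exact e
  have hφ : ∀ w, components p (chartPoint p y) (S.φ (chartPoint p y) w)
      = chartEndomorphism S.φ p y (components p (chartPoint p y) w) := by
    intro w
    simp only [chartEndomorphism, ContinuousLinearMap.comp_apply, ofComponents_components hq]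
  have h := congrArg (components p (chartPoint p y)) (S.normal _ _ _ hX hY)
  rw [nijenhuis, mlieBracket_constField p u v hy, ← S.chartMetric_chartEndomorphism hy,
    map_zero, map_zero, map_zero, add_zero, map_add, map_sub, map_sub, map_smul, hφ, hφ, h1, h2,
    h3, map_neg, sub_neg_eq_add] at h
  exact h

/-- A Sasakian structure in the preferred chart at `p`. -/
lemma isLocalSasakian (p : N) :
    IsLocalSasakian (chartDomain (2 * n + 1) p) (chartMetric S.g p) (chartConnection S.g p)
      (chartEndomorphism S.φ p) (chartField S.ξ p) (chartForm S.η p) where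
  toIsLocalLeviCivita := isLocalLeviCivita_chartConnection S.g p
  smooth_Φ := S.contDiffOn_chartEndomorphism p
  smooth_Ξ := contDiffOn_chartField S.smooth_ξ p
  smooth_H := S.contDiffOn_chartForm p
  almostContact _ hy := S.isAlmostContactMetric hy
  contact _ hy := S.fderiv_chartForm hy
  normal _ hy := S.chart_normal hy

/-- In a Sasakian space form with `c = 1`, `R(T, X)T = -X` for `T` a unit vector and `X`
orthogonal to `T`. -/
lemma IsSpaceForm.curvatureOp_eq {S : SasakianStructure n N} (hS : S.IsSpaceForm 1) (p : N)
    {T X : TangentSpace (𝓡 (2 * n + 1)) p} (hT : S.g.inner p T T = 1)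
    (hX : S.g.inner p T X = 0) : curvatureOp S.g p T X T = -X := by
  have hq := mem_chart_source (EuclideanSpace ℝ (Fin (2 * n + 1))) p
  refine components_injective p ?_
  rw [components_curvatureOp, map_neg]
  refine (S.isLocalSasakian p).curvature_eq (mem_chartDomain p) ?_ ?_ ?_
  · intro v
    obtain ⟨w, rfl⟩ : ∃ w : TangentSpace (𝓡 (2 * n + 1)) p, components p p w = v :=
      ⟨ofComponents p p v, components_ofComponents hq v⟩
    rw [chartField_self, chartEndomorphism_components, ← components_curvatureOp]
    simp only [chartMetric_components]
    exact hS p w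
  · rw [chartMetric_components, hT]
  · rw [chartMetric_components, hX]

end SasakianStructure

/-! ### Covariant differentiation along a curve. -/

section CovariantDerivative

open Filter Topology

variable {m : ℕ} {M : Type*} [TopologicalSpace M] [ChartedSpace (EuclideanSpace ℝ (Fin m)) M]

lemma hasDerivAt_extChartAt_comp {γ : ℝ → M} {t : ℝ}
    (hγ : MDifferentiableAt 𝓘(ℝ, ℝ) (𝓡 m) γ t) :
    HasDerivAt (fun s => extChartAt (𝓡 m) (γ t) (γ s)) (velocity m γ t) t := by
  have h := hγ.hasMFDerivAt.2
  simp only [writtenInExtChartAt, extChartAt_model_space_eq_id, modelWithCornersSelf_coe,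
    range_id] at h
  let L : ℝ →L[ℝ] EuclideanSpace ℝ (Fin m) := mfderiv 𝓘(ℝ, ℝ) (𝓡 m) γ t
  have h' : HasFDerivAt (fun s => extChartAt (𝓡 m) (γ t) (γ s)) L t := hasFDerivWithinAt_univ.1 h
  exact h'.hasDerivAt

lemma eventually_mem_chartAt_source {γ : ℝ → M} {t : ℝ} (hγ : ContinuousAt γ t) :
    ∀ᶠ s in 𝓝 t, γ s ∈ (chartAt (EuclideanSpace ℝ (Fin m)) (γ t)).source :=
  hγ.eventually ((chartAt (EuclideanSpace ℝ (Fin m)) (γ t)).open_source.mem_nhds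
    (mem_chart_source _ _))

variable [IsManifold (𝓡 m) ∞ M]

/-- The vector field `V` along the curve `γ` is differentiable at time `t`, with covariant
derivative `V'`. -/
structure HasCovDerivAlongAt (g : SmoothMetric m M) (γ : ℝ → M)
    (V : ∀ t, TangentSpace (𝓡 m) (γ t)) (t : ℝ) (V' : TangentSpace (𝓡 m) (γ t)) : Prop where
  differentiableAt : DifferentiableAt ℝ (fun s => components (γ t) (γ s) (V s)) t
  covDerivAlong_eq : covDerivAlong g γ V t = V'

/-- The covariant derivative at `t` depends only on the germ of the field. A field known only
through a formula valid on the open set `I` can therefore be differentiated by that formula. -/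
lemma covDerivAlong_congr (g : SmoothMetric m M) (γ : ℝ → M)
    {V W : ∀ t, TangentSpace (𝓡 m) (γ t)} {t : ℝ} (h : ∀ᶠ s in 𝓝 t, V s = W s) :
    covDerivAlong g γ V t = covDerivAlong g γ W t := by
  have h' : (fun s => (trivializationAt (EuclideanSpace ℝ (Fin m))
      (fun x : M => TangentSpace (𝓡 m) x) (γ t) ⟨γ s, V s⟩).2) =ᶠ[𝓝 t]
      fun s => (trivializationAt (EuclideanSpace ℝ (Fin m))
      (fun x : M => TangentSpace (𝓡 m) x) (γ t) ⟨γ s, W s⟩).2 := by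
    filter_upwards [h] with s hs
    rw [hs]
  simp only [covDerivAlong]
  rw [h'.deriv_eq, h.self_of_nhds]

variable {g : SmoothMetric m M} {γ : ℝ → M} {V W : ∀ t, TangentSpace (𝓡 m) (γ t)} {t : ℝ}

lemma components_covDerivAlong (g : SmoothMetric m M) (hγ : ContinuousAt γ t)
    (V : ∀ t, TangentSpace (𝓡 m) (γ t)) :
    components (γ t) (γ t) (covDerivAlong g γ V t)
      = deriv (fun s => components (γ t) (γ s) (V s)) t
        + chartConnection g (γ t) (extChartAt (𝓡 m) (γ t) (γ t))
          (components (γ t) (γ t) (velocity m γ t)) (components (γ t) (γ t) (V t)) := by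
  have h' : (fun s => components (γ t) (γ s) (V s)) =ᶠ[𝓝 t]
      fun s => (trivializationAt (EuclideanSpace ℝ (Fin m))
      (fun x : M => TangentSpace (𝓡 m) x) (γ t) ⟨γ s, V s⟩).2 := by
    filter_upwards [eventually_mem_chartAt_source (m := m) hγ] with s hs
      using components_eq_trivializationAt hs _
  have key : ∀ u v : EuclideanSpace ℝ (Fin m), u = velocity m γ t → v = V t →
      covDerivAlong g γ V t = deriv (fun s => components (γ t) (γ s) (V s)) t
        + chartConnection g (γ t) (extChartAt (𝓡 m) (γ t) (γ t)) u v := by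
    rintro _ _ rfl rfl
    rw [h'.deriv_eq]
    exact congrArg (_ + ·) (christoffel_eq g (mem_chartDomain (γ t)) _ _)
  exact (components_self _ _).trans (key _ _ (components_self _ _) (components_self _ _))

namespace HasCovDerivAlongAt

variable {V' W' : TangentSpace (𝓡 m) (γ t)}

lemma congr (h : HasCovDerivAlongAt g γ V t V') (hVW : ∀ᶠ s in 𝓝 t, W s = V s) :
    HasCovDerivAlongAt g γ W t V' where
  differentiableAt := by
    refine h.differentiableAt.congr_of_eventuallyEq ?_
    filter_upwards [hVW] with s hs
    rw [hs]
  covDerivAlong_eq := (covDerivAlong_congr g γ hVW).trans h.covDerivAlong_eq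

lemma zero (hγ : ContinuousAt γ t) : HasCovDerivAlongAt g γ (fun _ => 0) t 0 where
  differentiableAt := by simp only [map_zero]; exact differentiableAt_const _
  covDerivAlong_eq := by
    refine components_injective _ ?_
    rw [components_covDerivAlong g hγ]
    simp only [map_zero, deriv_const, add_zero]

lemma add (hγ : ContinuousAt γ t) (hV : HasCovDerivAlongAt g γ V t V')
    (hW : HasCovDerivAlongAt g γ W t W') :
    HasCovDerivAlongAt g γ (fun s => V s + W s) t (V' + W') where
  differentiableAt := by
    simp only [map_add]
    exact hV.differentiableAt.add hW.differentiableAt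
  covDerivAlong_eq := by
    refine components_injective _ ?_
    rw [components_covDerivAlong g hγ, ← hV.covDerivAlong_eq, ← hW.covDerivAlong_eq,
      (components (γ t) (γ t)).map_add (covDerivAlong g γ V t), components_covDerivAlong g hγ,
      components_covDerivAlong g hγ]
    simp only [map_add]
    rw [deriv_fun_add hV.differentiableAt hW.differentiableAt]
    abel

lemma smul (hγ : ContinuousAt γ t) {f : ℝ → ℝ} {f' : ℝ} (hf : HasDerivAt f f' t)
    (hV : HasCovDerivAlongAt g γ V t V') :
    HasCovDerivAlongAt g γ (fun s => f s • V s) t (f' • V t + f t • V') where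
  differentiableAt := by
    simp only [map_smul]
    exact hf.differentiableAt.smul hV.differentiableAt
  covDerivAlong_eq := by
    refine components_injective _ ?_
    rw [components_covDerivAlong g hγ, ← hV.covDerivAlong_eq,
      (components (γ t) (γ t)).map_add (f' • V t),
      (components (γ t) (γ t)).map_smul (f t) (covDerivAlong g γ V t),
      components_covDerivAlong g hγ]
    simp only [map_smul]
    rw [deriv_fun_smul hf.differentiableAt hV.differentiableAt, hf.deriv, smul_add]
    abel

end HasCovDerivAlongAt

lemma SmoothAlongOn.hasCovDerivAlongAt {I : Set ℝ} (hI : IsOpen I) (g : SmoothMetric m M)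
    (hγ : ContinuousAt γ t) (hV : SmoothAlongOn m I γ V) (ht : t ∈ I) :
    HasCovDerivAlongAt g γ V t (covDerivAlong g γ V t) where
  differentiableAt := by
    have h := hV.contMDiffAt (hI.mem_nhds ht)
    rw [contMDiffAt_totalSpace] at h
    refine (h.2.contDiffAt.differentiableAt (by simp)).congr_of_eventuallyEq ?_
    filter_upwards [eventually_mem_chartAt_source (m := m) hγ] with s hs
      using components_eq_trivializationAt hs _
  covDerivAlong_eq := rfl

end CovariantDerivative

section Sasakian

open Filter Topology

variable {n : ℕ} {N : Type*} [TopologicalSpace N]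
  [ChartedSpace (EuclideanSpace ℝ (Fin (2 * n + 1))) N] [IsManifold (𝓡 (2 * n + 1)) ∞ N]
  (S : SasakianStructure n N) {γ : ℝ → N} {t : ℝ} {V : ∀ t, TangentSpace (𝓡 (2 * n + 1)) (γ t)}
  {V' : TangentSpace (𝓡 (2 * n + 1)) (γ t)}

/-- The product rule with `(∇_T η)(V) = g(V, ∇_T ξ) = -g(V, φT)`. -/
lemma HasCovDerivAlongAt.hasDerivAt_η (hγ : MDifferentiableAt 𝓘(ℝ, ℝ) (𝓡 (2 * n + 1)) γ t)
    (hV : HasCovDerivAlongAt S.g γ V t V') :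
    HasDerivAt (fun s => S.η (γ s) (V s))
      (S.η (γ t) V' - S.g.inner (γ t) (V t) (S.φ (γ t) (velocity (2 * n + 1) γ t))) t := by
  have hp := mem_chart_source (EuclideanSpace ℝ (Fin (2 * n + 1))) (γ t)
  have hL := S.isLocalSasakian (γ t)
  have hy := mem_chartDomain (m := 2 * n + 1) (γ t)
  have hc := hasDerivAt_extChartAt_comp hγ
  have hH := hL.smooth_H.differentiableAt_of_isOpen hL.isOpen hy
  have hHc : HasDerivAt (fun s => chartForm S.η (γ t) (extChartAt (𝓡 (2 * n + 1)) (γ t) (γ s)))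
      (fderiv ℝ (chartForm S.η (γ t)) (extChartAt (𝓡 (2 * n + 1)) (γ t) (γ t))
        (velocity (2 * n + 1) γ t)) t := by
    have h := HasFDerivAt.comp_hasDerivAt t hH.hasFDerivAt hc
    exact h
  have hmain := hHc.clm_apply hV.differentiableAt.hasDerivAt
  have hev : (fun s => S.η (γ s) (V s)) =ᶠ[𝓝 t] fun s =>
      chartForm S.η (γ t) (extChartAt (𝓡 (2 * n + 1)) (γ t) (γ s))
        (components (γ t) (γ s) (V s)) := by
    filter_upwards [eventually_mem_chartAt_source (m := 2 * n + 1) hγ.continuousAt] with s hs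
      using (chartForm_components S.η hs (V s)).symm
  refine (hmain.congr_of_eventuallyEq hev).congr_deriv ?_
  have e1 := hL.fderiv_form hy (components (γ t) (γ t) (velocity (2 * n + 1) γ t))
    (components (γ t) (γ t) (V t))
  rw [(hL.covDeriv hy).2, map_neg, chartEndomorphism_components, chartMetric_components] at e1
  have e2 := chartForm_components S.η hp V'
  rw [← hV.covDerivAlong_eq, components_covDerivAlong S.g hγ.continuousAt, map_add] at e2
  have e3 : fderiv ℝ (chartForm S.η (γ t)) (extChartAt (𝓡 (2 * n + 1)) (γ t) (γ t))
      (velocity (2 * n + 1) γ t) = fderiv ℝ (chartForm S.η (γ t))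
        (extChartAt (𝓡 (2 * n + 1)) (γ t) (γ t))
        (components (γ t) (γ t) (velocity (2 * n + 1) γ t)) :=
    congrArg _ (components_self _ _).symm
  rw [e3, e1, ← hV.covDerivAlong_eq, ← e2]
  ring

end Sasakian

/-! ### Frenet frames and the derivatives of the tension field. -/

section Frenet

open Filter Topology

variable {m : ℕ} {M : Type*} [TopologicalSpace M] [ChartedSpace (EuclideanSpace ℝ (Fin m)) M]
  [IsManifold (𝓡 m) ∞ M]

/-- The `i`-th vector of a Frenet frame of osculating order `r`, zero for `i` outside `[1, r]`. -/
def paddedFrame (r : ℕ) {γ : ℝ → M} (E : ℕ → ∀ t, TangentSpace (𝓡 m) (γ t)) (i : ℕ) (t : ℝ) :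
    TangentSpace (𝓡 m) (γ t) :=
  if i ∈ Icc 1 r then E i t else 0

/-- The `i`-th curvature of a Frenet curve of osculating order `r`, zero for `i` outside
`[1, r - 1]`. -/
def paddedCurvature (r : ℕ) (κ : ℕ → ℝ → ℝ) (i : ℕ) (t : ℝ) : ℝ :=
  if i ∈ Ico 1 r then κ i t else 0

/-- Padding by zero gives the Frenet equations one form for all `i ≥ 1` and all `r`. For `i = 1` the
term with index `i - 1 = 0` disappears through this coefficient. -/
lemma paddedCurvature_zero (r : ℕ) (κ : ℕ → ℝ → ℝ) (t : ℝ) : paddedCurvature r κ 0 t = 0 :=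
  if_neg (by simp)

namespace IsFrenetFrame

variable {g : SmoothMetric m M} {I : Set ℝ} {γ : ℝ → M} {r : ℕ}
  {E : ℕ → ∀ t, TangentSpace (𝓡 m) (γ t)} {κ : ℕ → ℝ → ℝ} {t : ℝ}

lemma mdifferentiableAt (h : IsFrenetFrame g I γ r E κ) (hI : IsOpen I) (ht : t ∈ I) :
    MDifferentiableAt 𝓘(ℝ, ℝ) (𝓡 m) γ t :=
  (h.smooth_curve.contMDiffAt (hI.mem_nhds ht)).mdifferentiableAt (by simp)

lemma continuousAt (h : IsFrenetFrame g I γ r E κ) (hI : IsOpen I) (ht : t ∈ I) :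
    ContinuousAt γ t := (h.mdifferentiableAt hI ht).continuousAt

lemma contDiffOn_paddedCurvature (h : IsFrenetFrame g I γ r E κ) (i : ℕ) :
    ContDiffOn ℝ ∞ (paddedCurvature r κ i) I := by
  by_cases hi : i ∈ Ico 1 r
  · exact (h.smooth_curvature i hi).congr fun s _ => if_pos hi
  · exact (contDiffOn_const (c := 0)).congr fun s _ => if_neg hi

lemma hasDerivAt_paddedCurvature (h : IsFrenetFrame g I γ r E κ) (hI : IsOpen I) (i : ℕ)
    (ht : t ∈ I) :
    HasDerivAt (paddedCurvature r κ i) (deriv (paddedCurvature r κ i) t) t :=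
  ((h.contDiffOn_paddedCurvature i).differentiableAt_of_isOpen hI ht).hasDerivAt

lemma hasDerivAt_deriv_paddedCurvature (h : IsFrenetFrame g I γ r E κ) (hI : IsOpen I) (i : ℕ)
    (ht : t ∈ I) : HasDerivAt (deriv (paddedCurvature r κ i))
      (deriv (deriv (paddedCurvature r κ i)) t) t := by
  have hd : ContDiffOn ℝ ∞ (deriv (paddedCurvature r κ i)) I :=
    (h.contDiffOn_paddedCurvature i).deriv_of_isOpen hI (by norm_cast)
  exact (hd.differentiableAt_of_isOpen hI ht).hasDerivAt

lemma inner_paddedFrame (h : IsFrenetFrame g I γ r E κ) (ht : t ∈ I) (i j : ℕ) :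
    g.inner (γ t) (paddedFrame r E i t) (paddedFrame r E j t)
      = if i = j ∧ i ∈ Icc 1 r then 1 else 0 := by
  by_cases hi : i ∈ Icc 1 r
  · by_cases hj : j ∈ Icc 1 r
    · have e := h.orthonormal t ht i hi j hj
      simp only [paddedFrame, if_pos hj, hi, and_true, if_true]
      exact e
    · have hij : i ≠ j := fun e => hj (e ▸ hi)
      have e : paddedFrame r E j t = 0 := if_neg hj
      rw [e, map_zero, if_neg fun hh => hij hh.1]
  · have e : paddedFrame r E i t = 0 := if_neg hi
    rw [e, map_zero, zero_apply, if_neg fun hh => hi hh.2]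

lemma paddedFrame_one (h : IsFrenetFrame g I γ r E κ) (ht : t ∈ I) :
    paddedFrame r E 1 t = velocity m γ t :=
  (if_pos ⟨le_rfl, h.one_le⟩).trans (h.velocity_eq t ht)

/-- The Frenet equations. -/
lemma hasCovDerivAlongAt_paddedFrame (h : IsFrenetFrame g I γ r E κ) (hI : IsOpen I) (ht : t ∈ I)
    {i : ℕ} (hi : 1 ≤ i) : HasCovDerivAlongAt g γ (paddedFrame r E i) t
      (-(paddedCurvature r κ (i - 1) t • paddedFrame r E (i - 1) t)
        + paddedCurvature r κ i t • paddedFrame r E (i + 1) t) := by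
  have hγ := h.continuousAt hI ht
  by_cases hir : i ≤ r
  · have hmem : i ∈ Icc 1 r := ⟨hi, hir⟩
    have hE := (h.smooth_frame i hmem).hasCovDerivAlongAt hI g hγ ht
    rw [h.frenet t ht i hmem] at hE
    have hF : paddedFrame r E i = E i := funext fun s => if_pos hmem
    rw [hF]
    convert hE using 2
    · by_cases h1 : 1 < i
      · rw [if_pos h1, paddedCurvature, paddedFrame, if_pos ⟨by omega, by omega⟩,
          if_pos ⟨by omega, by omega⟩]
      · have : i - 1 = 0 := by omega
        rw [if_neg h1, this, paddedCurvature_zero, zero_smul, neg_zero]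
    · by_cases h2 : i < r
      · rw [if_pos h2, paddedCurvature, paddedFrame, if_pos ⟨by omega, by omega⟩,
          if_pos ⟨by omega, by omega⟩]
      · rw [if_neg h2, paddedCurvature, if_neg fun hh => h2 hh.2, zero_smul]
  · have hF : paddedFrame r E i = fun _ => 0 := funext fun s => if_neg fun hh => hir hh.2
    -- For `i > r` the index `i - 1` is at least `r`, already outside the range `[1, r - 1]` of the
    -- curvatures.
    have h1 : paddedCurvature r κ (i - 1) t = 0 := if_neg fun hh => by
      have := hh.2
      omega
    have h2 : paddedCurvature r κ i t = 0 := if_neg fun hh => by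
      have := hh.2
      omega
    rw [hF, h1, h2, zero_smul, zero_smul, neg_zero, add_zero]
    exact HasCovDerivAlongAt.zero hγ

lemma tensionField_eq (h : IsFrenetFrame g I γ r E κ) (hI : IsOpen I) (ht : t ∈ I) :
    tensionField g γ t = paddedCurvature r κ 1 t • paddedFrame r E 2 t := by
  have h1 := h.hasCovDerivAlongAt_paddedFrame hI ht le_rfl
  rw [tsub_self, paddedCurvature_zero, zero_smul, neg_zero, zero_add] at h1
  refine (h1.congr ?_).covDerivAlong_eq
  filter_upwards [hI.mem_nhds ht] with s hs using (h.paddedFrame_one hs).symm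

/-- The formula for the tension field holds at every time in `I`, so the next derivative is one of a
combination of smooth frame fields. Iterated derivatives thus require no comparison between the
charts at different points of the curve. -/
lemma covDerivAlong_tensionField (h : IsFrenetFrame g I γ r E κ) (hI : IsOpen I) (ht : t ∈ I) :
    covDerivAlong g γ (tensionField g γ) t =
      (-paddedCurvature r κ 1 t ^ 2) • paddedFrame r E 1 t
      + deriv (paddedCurvature r κ 1) t • paddedFrame r E 2 t
      + (paddedCurvature r κ 1 t * paddedCurvature r κ 2 t) • paddedFrame r E 3 t := by
  have hγ := h.continuousAt hI ht
  have h2 := (h.hasCovDerivAlongAt_paddedFrame hI ht one_le_two).smul hγ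
    (h.hasDerivAt_paddedCurvature hI 1 ht)
  refine (h2.congr ?_).covDerivAlong_eq.trans ?_
  · filter_upwards [hI.mem_nhds ht] with s hs using h.tensionField_eq hI hs
  · module

/-- The second covariant derivative of the tension field of a Frenet curve. -/
lemma covDerivAlong_covDerivAlong_tensionField (h : IsFrenetFrame g I γ r E κ) (hI : IsOpen I)
    (ht : t ∈ I) : covDerivAlong g γ (covDerivAlong g γ (tensionField g γ)) t =
      (-3 * (paddedCurvature r κ 1 t * deriv (paddedCurvature r κ 1) t)) • paddedFrame r E 1 t
      + (deriv (deriv (paddedCurvature r κ 1)) t - paddedCurvature r κ 1 t ^ 3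
        - paddedCurvature r κ 1 t * paddedCurvature r κ 2 t ^ 2) • paddedFrame r E 2 t
      + (2 * deriv (paddedCurvature r κ 1) t * paddedCurvature r κ 2 t
        + paddedCurvature r κ 1 t * deriv (paddedCurvature r κ 2) t) • paddedFrame r E 3 t
      + (paddedCurvature r κ 1 t * paddedCurvature r κ 2 t * paddedCurvature r κ 3 t) •
        paddedFrame r E 4 t := by
  have hγ := h.continuousAt hI ht
  have hK := h.hasDerivAt_paddedCurvature hI 1 ht
  have h1 := (h.hasCovDerivAlongAt_paddedFrame hI ht le_rfl).smul hγ (hK.pow 2).neg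
  have h2 := (h.hasCovDerivAlongAt_paddedFrame hI ht one_le_two).smul hγ
    (h.hasDerivAt_deriv_paddedCurvature hI 1 ht)
  have h3 := (h.hasCovDerivAlongAt_paddedFrame hI ht (i := 3) (by norm_num)).smul hγ
    (hK.mul (h.hasDerivAt_paddedCurvature hI 2 ht))
  refine ((((h1.add hγ h2).add hγ h3)).congr ?_).covDerivAlong_eq.trans ?_
  · filter_upwards [hI.mem_nhds ht] with s hs using h.covDerivAlong_tensionField hI hs
  · simp only [tsub_self, paddedCurvature_zero, zero_smul, neg_zero, zero_add, Pi.neg_apply,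
      Pi.pow_apply, Pi.mul_apply, Nat.reduceSub, Nat.reduceAdd, Nat.cast_ofNat, pow_one]
    module

end IsFrenetFrame

end Frenet

/-! ### The obstruction in dimension at most 3. -/

namespace IsAlmostContactMetric

variable {E : Type*} [NormedAddCommGroup E] [NormedSpace ℝ E]
  {g : E →L[ℝ] E →L[ℝ] ℝ} {φ : E →L[ℝ] E} {ξ : E} {η : E →L[ℝ] ℝ}

lemma g_φ_self (h : IsAlmostContactMetric g φ ξ η) (X : E) : g X (φ X) = 0 := by
  have h1 := h.φ_skew X X
  rw [h.symm] at h1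
  linarith

variable [FiniteDimensional ℝ E]

/-- In dimension at most `3`, an orthonormal pair of vectors orthogonal to `ξ` is `φ`-invariant. -/
lemma sq_g_φ_eq_one (h : IsAlmostContactMetric g φ ξ η) (hdim : Module.finrank ℝ E ≤ 3) {T W : E}
    (hT : g T T = 1) (hW : g W W = 1) (hTW : g T W = 0) (hηT : η T = 0) (hηW : η W = 0) :
    g W (φ T) ^ 2 = 1 := by
  have hφφ : g (φ T) (φ T) = 1 := by rw [h.g_φ_φ, hT, hηT]; ring
  have hTφ := h.g_φ_self T
  have hξξ : g ξ ξ = 1 := by rw [h.g_ξ, h.η_ξ]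
  have hTξ : g T ξ = 0 := by rw [h.g_ξ, hηT]
  have hφξ : g (φ T) ξ = 0 := by rw [h.g_ξ, h.η_φ]
  have hWξ : g W ξ = 0 := by rw [h.g_ξ, hηW]
  set a := g W (φ T) with ha
  -- `v` is orthogonal to `T`, `φT` and `ξ`, with `g(v, v) = 1 - a²`. Were this nonzero, four
  -- nonzero orthogonal vectors would fit in dimension 3.
  set v := W - a • φ T with hv
  have hTv : g T v = 0 := by simp [hv, hTW, hTφ]
  have hφv : g (φ T) v = 0 := by simp [hv, hφφ, ha, h.symm (φ T) W]
  have hξv : g ξ v = 0 := by simp [hv, h.symm ξ W, h.symm ξ (φ T), hWξ, hφξ]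
  have hvv : g v v = 1 - a ^ 2 := by
    have : g v v = g W v - a * g (φ T) v := by simp [hv]
    rw [this, hφv]
    simp only [hv, map_sub, map_smul, smul_eq_mul, hW, ← ha]
    ring
  by_contra hne
  have hv0 : g v v ≠ 0 := fun h0 => hne (by linarith)
  have hφT := (h.symm (φ T) T).trans hTφ
  have hξT := (h.symm ξ T).trans hTξ
  have hvT := (h.symm v T).trans hTv
  have hξφ := (h.symm ξ (φ T)).trans hφξ
  have hvφ := (h.symm v (φ T)).trans hφv
  have hvξ := (h.symm v ξ).trans hξv
  clear_value v
  have hli : LinearIndependent ℝ ![T, φ T, ξ, v] := by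
    refine LinearMap.BilinForm.linearIndependent_of_iIsOrtho
      (B := LinearMap.mk₂ ℝ (fun X Y => g X Y) (by simp) (by simp) (by simp) (by simp)) ?_ ?_
    · intro i j hij
      fin_cases i <;> fin_cases j <;> first | exact (hij rfl).elim | assumption
    · intro i
      fin_cases i
      exacts [hT.trans_ne one_ne_zero, hφφ.trans_ne one_ne_zero, hξξ.trans_ne one_ne_zero, hv0]
  have := hli.fintype_card_le_finrank
  simp at this
  omega

end IsAlmostContactMetric

namespace ContactMetricStructure

variable {n : ℕ} {N : Type*} [TopologicalSpace N]
  [ChartedSpace (EuclideanSpace ℝ (Fin (2 * n + 1))) N] [IsManifold (𝓡 (2 * n + 1)) ∞ N]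
  (S : ContactMetricStructure n N) {p : N}

lemma isAlmostContactMetric_tangentSpace (p : N) :
    IsAlmostContactMetric (E := EuclideanSpace ℝ (Fin (2 * n + 1)))
      (S.g.inner p) (S.φ p) (S.ξ p) (S.η p) where
  symm := S.g.symm p
  pos := S.g.pos p
  φ_φ := S.φ_φ p
  η_ξ := S.η_ξ p
  g_φ_φ := S.g_φ_φ p

lemma inner_φ_self (X : TangentSpace (𝓡 (2 * n + 1)) p) : S.g.inner p X (S.φ p X) = 0 :=
  (S.isAlmostContactMetric_tangentSpace p).g_φ_self X

/-- The difference of the two sides is `g(φX, φX)`. -/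
lemma sq_η_le_inner (X : TangentSpace (𝓡 (2 * n + 1)) p) : S.η p X ^ 2 ≤ S.g.inner p X X := by
  have h := S.g_φ_φ p X X
  by_cases h0 : S.φ p X = 0
  · rw [h0, map_zero] at h
    have : (0 : ℝ) = S.g.inner p X X - S.η p X * S.η p X := h
    linarith [sq (S.η p X)]
  · have := S.g.pos p _ h0
    linarith [sq (S.η p X)]

lemma sq_inner_φ_eq_one (hn : n ≤ 1) {T W : TangentSpace (𝓡 (2 * n + 1)) p}
    (hT : S.g.inner p T T = 1) (hW : S.g.inner p W W = 1) (hTW : S.g.inner p T W = 0)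
    (hηT : S.η p T = 0) (hηW : S.η p W = 0) : S.g.inner p W (S.φ p T) ^ 2 = 1 := by
  refine (S.isAlmostContactMetric_tangentSpace p).sq_g_φ_eq_one ?_ hT hW hTW hηT hηW
  rw [finrank_euclideanSpace_fin]
  omega

end ContactMetricStructure

/-! ### Biharmonic and Legendre Frenet curves in the space form. -/

namespace IsFrenetFrame

open Filter Topology

variable {n : ℕ} {N : Type*} [TopologicalSpace N]
  [ChartedSpace (EuclideanSpace ℝ (Fin (2 * n + 1))) N] [IsManifold (𝓡 (2 * n + 1)) ∞ N]
  {S : SasakianStructure n N} {I : Set ℝ} {γ : ℝ → N} {r : ℕ}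
  {E : ℕ → ∀ t, TangentSpace (𝓡 (2 * n + 1)) (γ t)} {κ : ℕ → ℝ → ℝ} {t : ℝ}

/-- The bitension field of a Frenet curve in a Sasakian space form with `c = 1`. -/
lemma bitensionField_eq (h : IsFrenetFrame S.g I γ r E κ) (hS : S.IsSpaceForm 1) (hI : IsOpen I)
    (ht : t ∈ I) : bitensionField S.g γ t =
      (-3 * (paddedCurvature r κ 1 t * deriv (paddedCurvature r κ 1) t)) • paddedFrame r E 1 t
      + (deriv (deriv (paddedCurvature r κ 1)) t - paddedCurvature r κ 1 t ^ 3
        - paddedCurvature r κ 1 t * paddedCurvature r κ 2 t ^ 2 + paddedCurvature r κ 1 t) •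
        paddedFrame r E 2 t
      + (2 * deriv (paddedCurvature r κ 1) t * paddedCurvature r κ 2 t
        + paddedCurvature r κ 1 t * deriv (paddedCurvature r κ 2) t) • paddedFrame r E 3 t
      + (paddedCurvature r κ 1 t * paddedCurvature r κ 2 t * paddedCurvature r κ 3 t) •
        paddedFrame r E 4 t := by
  have hR : curvatureOp S.g (γ t) (velocity (2 * n + 1) γ t) (tensionField S.g γ t)
      (velocity (2 * n + 1) γ t) = -tensionField S.g γ t := by
    rw [← h.paddedFrame_one ht]
    refine hS.curvatureOp_eq _ ?_ ?_
    · rw [h.inner_paddedFrame ht, if_pos ⟨rfl, le_rfl, h.one_le⟩]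
    · rw [h.tensionField_eq hI ht, map_smul, h.inner_paddedFrame ht, if_neg (by simp), smul_zero]
  rw [bitensionField, hR, h.covDerivAlong_covDerivAlong_tensionField hI ht,
    h.tensionField_eq hI ht]
  module

/-- Pairing with `E_i` isolates the `i`-th coefficient; the guards `i ≤ r` appear because the padded
`E_i` is zero beyond `r`. -/
lemma inner_bitensionField (h : IsFrenetFrame S.g I γ r E κ) (hS : S.IsSpaceForm 1) (hI : IsOpen I)
    (ht : t ∈ I) (hb : bitensionField S.g γ t = 0) :
    (1 ≤ r → paddedCurvature r κ 1 t * deriv (paddedCurvature r κ 1) t = 0) ∧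
    (2 ≤ r → deriv (deriv (paddedCurvature r κ 1)) t - paddedCurvature r κ 1 t ^ 3
        - paddedCurvature r κ 1 t * paddedCurvature r κ 2 t ^ 2 + paddedCurvature r κ 1 t = 0) ∧
    (3 ≤ r → 2 * deriv (paddedCurvature r κ 1) t * paddedCurvature r κ 2 t
        + paddedCurvature r κ 1 t * deriv (paddedCurvature r κ 2) t = 0) ∧
    (4 ≤ r → paddedCurvature r κ 1 t * paddedCurvature r κ 2 t * paddedCurvature r κ 3 t = 0) := by
  rw [h.bitensionField_eq hS hI ht] at hb
  have key : ∀ i, S.g.inner (γ t) (paddedFrame r E i t) _ = 0 := fun i =>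
    (congrArg (S.g.inner (γ t) (paddedFrame r E i t)) hb).trans (map_zero _)
  simp only [map_add, map_smul, h.inner_paddedFrame ht, smul_eq_mul] at key
  refine ⟨fun hr => ?_, fun hr => ?_, fun hr => ?_, fun hr => ?_⟩
  · simpa [hr] using key 1
  · simpa [hr] using key 2
  · simpa [hr] using key 3
  · simpa [hr] using key 4

/-- The derivatives of the function `η(E₁) = 0` along a Legendre Frenet curve. -/
lemma η_paddedFrame (h : IsFrenetFrame S.g I γ r E κ) (hI : IsOpen I) (hL : S.IsLegendre I γ)
    (hκ : ∀ t ∈ I, paddedCurvature r κ 1 t ≠ 0) (ht : t ∈ I) :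
    S.η (γ t) (paddedFrame r E 1 t) = 0 ∧ S.η (γ t) (paddedFrame r E 2 t) = 0 ∧
    S.g.inner (γ t) (paddedFrame r E 2 t) (S.φ (γ t) (paddedFrame r E 1 t))
      = paddedCurvature r κ 2 t * S.η (γ t) (paddedFrame r E 3 t) := by
  have hη1 : ∀ s ∈ I, S.η (γ s) (paddedFrame r E 1 s) = 0 := fun s hs => by
    rw [h.paddedFrame_one hs]
    exact hL s hs
  -- A field in `ker η` satisfies `η(∇_T V) = g(V, φT)`. Taking `V = E₁`, where `g(T, φT) = 0`, and
  -- then `V = E₂` gives the claims.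
  have hder : ∀ V : ∀ t, TangentSpace (𝓡 (2 * n + 1)) (γ t), (∀ s ∈ I, S.η (γ s) (V s) = 0) →
      ∀ s ∈ I, ∀ V', HasCovDerivAlongAt S.g γ V s V' →
      S.η (γ s) V' - S.g.inner (γ s) (V s) (S.φ (γ s) (paddedFrame r E 1 s)) = 0 := by
    intro V hV s hs V' hV'
    rw [h.paddedFrame_one hs]
    refine (hV'.hasDerivAt_η S (h.mdifferentiableAt hI hs)).unique
      ((hasDerivAt_const s (0 : ℝ)).congr_of_eventuallyEq ?_)
    filter_upwards [hI.mem_nhds hs] with u hu using hV u hu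
  have hη2 : ∀ s ∈ I, S.η (γ s) (paddedFrame r E 2 s) = 0 := by
    intro s hs
    have e := hder _ hη1 s hs _ (h.hasCovDerivAlongAt_paddedFrame hI hs le_rfl)
    rw [tsub_self, paddedCurvature_zero, zero_smul, neg_zero, zero_add, S.inner_φ_self, sub_zero,
      map_smul] at e
    exact (smul_eq_zero.1 e).resolve_left (hκ s hs)
  refine ⟨hη1 t ht, hη2 t ht, ?_⟩
  have e := hder _ hη2 t ht _ (h.hasCovDerivAlongAt_paddedFrame hI ht one_le_two)
  rw [map_add, map_neg, map_smul, map_smul, hη1 t ht, smul_zero, neg_zero, zero_add,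
    smul_eq_mul] at e
  exact (sub_eq_zero.1 e).symm

/-- A Legendre Frenet curve with `κ₁ ≠ 0` and `|κ₂| < 1` needs room. -/
lemma two_le_of_sq_lt_one (h : IsFrenetFrame S.g I γ r E κ) (hI : IsOpen I)
    (hL : S.IsLegendre I γ) (hr : 2 ≤ r) (hκ : ∀ t ∈ I, paddedCurvature r κ 1 t ≠ 0) (ht : t ∈ I)
    (hκ₂ : paddedCurvature r κ 2 t ^ 2 < 1) : 2 ≤ n := by
  by_contra! hn
  obtain ⟨h1, h2, h3⟩ := h.η_paddedFrame hI hL hκ ht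
  have e := S.sq_inner_φ_eq_one (by omega)
    ((h.inner_paddedFrame ht 1 1).trans (if_pos ⟨rfl, le_rfl, h.one_le⟩))
    ((h.inner_paddedFrame ht 2 2).trans (if_pos ⟨rfl, one_le_two, hr⟩))
    ((h.inner_paddedFrame ht 1 2).trans (if_neg (by simp))) h1 h2
  -- `E₃` is a unit vector or, when `r = 2`, zero. Then `1 = g(E₂, φT)² = κ₂² η(E₃)² ≤ κ₂² < 1` is
  -- the contradiction.
  have hle : S.η (γ t) (paddedFrame r E 3 t) ^ 2 ≤ 1 := by
    refine (S.sq_η_le_inner _).trans ?_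
    rw [h.inner_paddedFrame ht]
    split_ifs <;> norm_num
  rw [h3, mul_pow] at e
  nlinarith [sq_nonneg (paddedCurvature r κ 2 t),
    sq_nonneg (S.η (γ t) (paddedFrame r E 3 t))]

/-- Frenet curves with constant curvatures `κ₁ > 0` and `κ₂` such that `κ₁² + κ₂² = 1` and `κ₃ = 0`
are proper-biharmonic. -/
lemma isProperBiharmonicCurve (h : IsFrenetFrame S.g I γ r E κ) (hS : S.IsSpaceForm 1)
    (hI : IsOpen I) (hne : I.Nonempty) (hr : 2 ≤ r) {k₁ k₂ : ℝ}
    (h1 : ∀ t ∈ I, paddedCurvature r κ 1 t = k₁) (h2 : ∀ t ∈ I, paddedCurvature r κ 2 t = k₂)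
    (h3 : ∀ t, paddedCurvature r κ 3 t = 0) (hk : k₁ ^ 2 + k₂ ^ 2 = 1) :
    IsProperBiharmonicCurve S.g I γ := by
  have hd : ∀ (f : ℝ → ℝ) (c : ℝ), (∀ t ∈ I, f t = c) → ∀ t ∈ I, deriv f t = 0 := by
    intro f c hf t ht
    have : f =ᶠ[𝓝 t] fun _ => c := by
      filter_upwards [hI.mem_nhds ht] with s hs using hf s hs
    rw [this.deriv_eq, deriv_const]
  refine ⟨fun t ht => ?_, fun hh => ?_⟩
  · have e : k₁ = k₁ ^ 3 + k₁ * k₂ ^ 2 := by linear_combination -k₁ * hk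
    rw [h.bitensionField_eq hS hI ht, hd _ 0 (hd _ _ h1) t ht, hd _ _ h1 t ht, hd _ _ h2 t ht,
      h1 t ht, h2 t ht, h3]
    have e2 : 0 - k₁ ^ 3 - k₁ * k₂ ^ 2 + k₁ = 0 := by linear_combination e
    rw [e2]
    simp only [mul_zero, zero_mul, zero_smul, add_zero]
  · obtain ⟨t, ht⟩ := hne
    have e := hh t ht
    rw [h.tensionField_eq hI ht] at e
    -- The `E₂` component of the tension field is `κ₁ > 0`, so the curve is not harmonic.
    have e' := (congrArg (S.g.inner (γ t) (paddedFrame r E 2 t)) e).trans (map_zero _)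
    rw [map_smul, h.inner_paddedFrame ht, if_pos ⟨rfl, one_le_two, hr⟩, smul_eq_mul,
      mul_one] at e'
    have hpos := h.curvature_pos t ht 1 ⟨le_rfl, hr⟩
    rw [paddedCurvature, if_pos ⟨le_rfl, hr⟩] at e'
    exact hpos.ne' e'

end IsFrenetFrame

end

/-! ### The classification. -/

theorem mainTheorem1 (n : ℕ) {N : Type*} [TopologicalSpace N] [T2Space N]
    [SecondCountableTopology N] [ChartedSpace (EuclideanSpace ℝ (Fin (2 * n + 1))) N]
    [IsManifold (𝓡 (2 * n + 1)) ∞ N]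
    (S : SasakianStructure n N) (hS : S.IsSpaceForm 1)
    (I : Set ℝ) (hI_open : IsOpen I) (hI_interval : I.OrdConnected) (hI_nonempty : I.Nonempty)
    (γ : ℝ → N) (r : ℕ) (hγ : IsFrenetCurve S.g I γ r) (hγ_legendre : S.IsLegendre I γ) :
    IsProperBiharmonicCurve S.g I γ ↔
      2 ≤ n ∧ (IsCircle S.g I γ 1 ∨
        ∃ k₁ k₂ : ℝ, IsHelix S.g I γ k₁ k₂ ∧ k₁ ^ 2 + k₂ ^ 2 = 1) := by
  constructor
  · rintro ⟨hb, hh⟩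
    obtain ⟨E, κ, h⟩ := hγ
    -- For `r = 1` the padded `κ₁` is zero and the curve is a geodesic, hence harmonic.
    have hr : 2 ≤ r := by
      by_contra! hr
      refine hh fun t ht => ?_
      rw [h.tensionField_eq hI_open ht, paddedCurvature, if_neg fun hm => by have := hm.2; omega,
        zero_smul]
    have hκ : ∀ i t, i ∈ Ico 1 r → paddedCurvature r κ i t = κ i t := fun i t hi => if_pos hi
    have hpos : ∀ t ∈ I, 0 < paddedCurvature r κ 1 t := fun t ht => by
      rw [hκ _ _ ⟨le_rfl, hr⟩]
      exact h.curvature_pos t ht 1 ⟨le_rfl, hr⟩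
    have hconst : ∀ i, (∀ t ∈ I, deriv (paddedCurvature r κ i) t = 0) → ∃ k, ∀ t ∈ I,
        paddedCurvature r κ i t = k := fun i hi =>
      hI_open.exists_is_const_of_deriv_eq_zero hI_interval.isPreconnected
        ((h.contDiffOn_paddedCurvature i).differentiableOn (by simp)) hi
    have hcomp := fun t ht => h.inner_bitensionField hS hI_open ht (hb t ht)
    have hd1 : ∀ t ∈ I, deriv (paddedCurvature r κ 1) t = 0 := fun t ht =>
      (mul_eq_zero.1 ((hcomp t ht).1 h.one_le)).resolve_left (hpos t ht).ne'
    have hdd1 : ∀ t ∈ I, deriv (deriv (paddedCurvature r κ 1)) t = 0 := fun t ht => by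
      have : deriv (paddedCurvature r κ 1) =ᶠ[nhds t] fun _ => 0 := by
        filter_upwards [hI_open.mem_nhds ht] with s hs using hd1 s hs
      rw [this.deriv_eq, deriv_const]
    have hsum : ∀ t ∈ I, paddedCurvature r κ 1 t ^ 2 + paddedCurvature r κ 2 t ^ 2 = 1 := by
      intro t ht
      have e := (hcomp t ht).2.1 hr
      rw [hdd1 t ht] at e
      -- With `κ₁'' = 0` the `E₂` component is `κ₁(1 - κ₁² - κ₂²)`, and `κ₁ > 0` cancels.
      refine mul_left_cancel₀ (hpos t ht).ne' ?_
      linear_combination -e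
    refine ⟨?_, ?_⟩
    · obtain ⟨t, ht⟩ := hI_nonempty
      refine h.two_le_of_sq_lt_one hI_open hγ_legendre hr (fun s hs => (hpos s hs).ne') ht ?_
      have := pow_pos (hpos t ht) 2
      linarith [hsum t ht]
    -- For `r ≥ 4` the `E₄` component `κ₁κ₂κ₃` would be positive.
    · have hr3 : r ≤ 3 := by
        by_contra! hr4
        obtain ⟨t, ht⟩ := hI_nonempty
        have e := (hcomp t ht).2.2.2 hr4
        rw [hκ 2 t ⟨by omega, by omega⟩, hκ 3 t ⟨by omega, by omega⟩] at e
        exact (mul_pos (mul_pos (hpos t ht) (h.curvature_pos t ht 2 ⟨by omega, by omega⟩))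
          (h.curvature_pos t ht 3 ⟨by omega, by omega⟩)).ne' e
      obtain rfl | rfl : r = 2 ∨ r = 3 := by omega
      · refine Or.inl ⟨E, κ, h, fun t ht => ?_⟩
        have e := hsum t ht
        have e2 : paddedCurvature 2 κ 2 t = 0 := if_neg (by simp)
        rw [e2] at e
        rw [← hκ 1 t ⟨le_rfl, by omega⟩]
        nlinarith [hpos t ht]
      · have hd2 : ∀ t ∈ I, deriv (paddedCurvature 3 κ 2) t = 0 := fun t ht => by
          have e := (hcomp t ht).2.2.1 le_rfl
          rw [hd1 t ht, mul_zero, zero_mul, zero_add] at e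
          exact (mul_eq_zero.1 e).resolve_left (hpos t ht).ne'
        obtain ⟨k₁, hk₁⟩ := hconst 1 hd1
        obtain ⟨k₂, hk₂⟩ := hconst 2 hd2
        refine Or.inr ⟨k₁, k₂, ⟨E, κ, h, fun t ht => ⟨?_, ?_⟩⟩, ?_⟩
        · rw [← hκ 1 t ⟨by omega, by omega⟩, hk₁ t ht]
        · rw [← hκ 2 t ⟨by omega, by omega⟩, hk₂ t ht]
        · obtain ⟨t, ht⟩ := hI_nonempty
          rw [← hsum t ht, hk₁ t ht, hk₂ t ht]
  · rintro ⟨-, ⟨E', κ, h, hκ⟩ | ⟨k₁, k₂, ⟨E', κ, h, hκ⟩, hk⟩⟩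
    -- A circle is the case `κ₂ = 0` of the same criterion, the padded second curvature being zero
    -- for order 2.
    · exact h.isProperBiharmonicCurve hS hI_open hI_nonempty le_rfl (k₁ := 1) (k₂ := 0)
        (fun t ht => (if_pos (by simp)).trans (hκ t ht)) (fun t _ => if_neg (by simp))
        (fun t => if_neg (by simp)) (by norm_num)
    · exact h.isProperBiharmonicCurve hS hI_open hI_nonempty (by norm_num)
        (fun t ht => (if_pos (by simp)).trans (hκ t ht).1)
        (fun t ht => (if_pos (by simp)).trans (hκ t ht).2) (fun t => if_neg (by simp)) hk
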